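/- **Setting.** Fix $d$ and $N\ge 2$, and a finite dimensional single-site Hilbert space $\mathcal H_0$; to each $x\in\mathbb Z^d$ attach a copy $\mathcal H_x$ of $\mathcal H_0$. * *Symmetry.* Let $R\mapsto\widehat R$ be a unitary representation of $SO(N)$ on $\mathcal H_0$, possibly only up to phase factors (so that half-integer spins are included), for which $R\mapsto \widehat R M\widehat R^{-1}$ is continuous for every operator $M$. Let $\widehat R_x$ be the copy of $\widehat R$ acting on $\mathcal H_x$, and $\widehat R_A=\bigotimes_{x\in A}\widehat R_x$. * *Interaction.* For every finite $A\subset\mathbb Z^d$ let $Q_A$ be a self-adjoint operator on $\bigotimes_{x\in A}\mathcal H_x$, such that the family is translation invariant and $\widehat R_A^{-1}Q_A\widehat R_A=Q_A$ for all $R\in SO(N)$. * *Field operators.* Let $\vec\kappa_0=(\kappa_{0,1},\dots,\kappa_{0,N})$ be self-adjoint operators on a finite set of sites $S$ (for example $S=\{0\}$) that transform as a vector, $\widehat R_S(\vec v\cdot\vec\kappa_0)\widehat R_S^{-1}=(R\vec v)\cdot\vec\kappa_0$ for all $R\in SO(N)$ and $\vec v\in\mathbb R^N$, and let $\vec\kappa_x$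 be their translates by $x$. * *Disorder.* Let $(\vec\eta_x)_{x\in\mathbb Z^d}$ be i.i.d. random vectors in $\mathbb R^N$ of finite variance, with a distribution invariant under $SO(N)$. * *Free energy.* Let $\Gamma_K=[-K,K]^d\cap\mathbb Z^d$, let $\epsilon\in\mathbb R$, and let $$H_K^{\vec h}(\vec\eta)=\sum_A P_K(Q_A)+\sum_{x\in\Gamma_K}(\vec h+\epsilon\vec\eta_x)\cdot P_K(\vec\kappa_x)$$ be the Hamiltonian with periodic boundary conditions. Here $P_K$ maps each site to the site of $\Gamma_K$ congruent to it modulo $2K+1$. The first sum is over finite nonempty $A$, one from each class modulo translations by $(2K+1)\mathbb Z^d$, that do not contain two congruent sites. For $0<\beta<\infty$ let $F_K^{\vec h}(\vec\eta)=-\beta^{-1}\log\operatorname{Tr}e^{-\beta H_K^{\vec h}(\vec\eta)}$; for $\beta=\infty$ let $F_K^{\vec h}(\vec\eta)$ be the lowest eigenvalue of $H_K^{\vec h}(\vec\eta)$. * *Free energy difference.* Let $\hat e\in\mathbb R^N$ be a unit vector and let $r_L\vec\eta$ be $\vec\eta$ with $\vec\eta_x$ replaced by $0$ for all $x\in\Gamma_L$.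 For $\delta\in\mathbb R$ put $$\mathcal G_{L,K}^{\delta\hat e}=\tfrac12\,\mathbb E\Big[F_K^{\delta\hat e}(\vec\eta)-F_K^{\delta\hat e}(r_L\vec\eta)-F_K^{-\delta\hat e}(\vec\eta)+F_K^{-\delta\hat e}(r_L\vec\eta)\,\Big|\,(\hat e\cdot\vec\eta_x)_{x\in\Gamma_L}\Big].$$ For sequences $\delta_i\to0$ and $K_j\to\infty$ put $$G_L=\lim_{i\to\infty}\lim_{j\to\infty}\big(\mathcal G_{L,K_j}^{\delta_i\hat e}-\mathbb E\,\mathcal G_{L,K_j}^{\delta_i\hat e}\big)$$ whenever these limits exist for almost every $\vec\eta$. **Lemma.** Suppose that the interaction is of finite range (there is $r$ with $Q_A=0$ whenever $\operatorname{diam}A>r$), or that $$\sum_{A\ni0}(\operatorname{diam}A)^2\,|A|\,\|Q_A\|<\infty .$$ Then there is a constant $C<\infty$, depending only on the interaction, the symmetry, $\vec\kappa_0$, $\epsilon$ and the distribution of the disorder, such that for every $\beta\in(0,\infty]$, every unit vector $\hat e$, every integer $L\ge1$ and all sequences $\delta_i\to0$, $K_j\to\infty$ for which the limit $G_L$ exists,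 $$|G_L|\le C\,L^{d-2}\qquad\text{for almost every }\vec\eta .$$ -/

import Mathlib

open MeasureTheory ProbabilityTheory Filter Topology Matrix

noncomputable section

namespace QuantumImryMa

/-- The sites of the lattice `ℤ^d`. -/
abbrev Site (d : ℕ) : Type := Fin d → ℤ

/-- The space `ℝ^N` of the field vectors, with its Euclidean norm. -/
abbrev Vec (N : ℕ) : Type := EuclideanSpace ℝ (Fin N)

/-- Operators on `⊗_{x ∈ X} ℂ^ι`, written in the product basis, which is indexed by `X → ι`. -/
abbrev Op (X ι : Type*) : Type _ := Matrix (X → ι) (X → ι) ℂ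

/-- The cube `[-L, L]^d ∩ ℤ^d`. -/
def box (d L : ℕ) : Finset (Site d) :=
  Fintype.piFinset fun _ => Finset.Icc (-(L : ℤ)) (L : ℤ)

/-- The translate `A + x`. -/
def translate {d : ℕ} (x : Site d) (A : Finset (Site d)) : Finset (Site d) :=
  A.map (addRightEmbedding x)

lemma add_mem_translate {d : ℕ} (x : Site d) {A : Finset (Site d)} (a : A) :
    (a : Site d) + x ∈ translate x A :=
  Finset.mem_map_of_mem (addRightEmbedding x) a.2

/-- The operator norm for the Euclidean norm. -/
def opNorm {X : Type*} [Fintype X] [DecidableEq X] (M : Matrix X X ℂ) : ℝ :=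
  ‖Matrix.toEuclideanCLM (n := X) (𝕜 := ℂ) M‖

/-- The tensor power `⊗_{x ∈ X} U` of a single-site operator. -/
def tensorPower (X : Type*) [Fintype X] {ι : Type*} (U : Matrix ι ι ℂ) : Op X ι :=
  fun σ τ => ∏ x, U (σ x) (τ x)

open Classical in
/-- The operator `M ⊗ 1` on the sites `Y`, where the operator `M` on the sites `X` is carried to the
sites `f(X)` by an injective `f`. It is set to `0` if `f` is not injective. -/
def embed {X Y ι : Type*} (f : X → Y) (M : Op X ι) : Op Y ι :=
  fun σ τ =>
    if Function.Injective f ∧ ∀ y, y ∉ Set.range f → σ y = τ y then M (σ ∘ f) (τ ∘ f) else 0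

/-- A rotation acting on a vector. -/
def rotate {N : ℕ} (R : Matrix.specialOrthogonalGroup (Fin N) ℝ) (v : Vec N) : Vec N :=
  WithLp.toLp 2 ((R : Matrix (Fin N) (Fin N) ℝ) *ᵥ v.ofLp)

/-- A translation invariant quantum lattice system on `ℤ^d` with single-site space `ℂ^ι` and a
rotation symmetry `SO(N)`.

The rotations act on the single-site space by unitary operators which multiply up to phases only, so
that half-integer spins are included; the action by conjugation is continuous. The field is coupled
to the vector operator `lop x = (lop x 1, …, lop x N)`, the translate by `x` of operators `lop`
acting on the finite set of sites `cluster`. -/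
structure SymmetricSystem (d N : ℕ) (ι : Type*) [Fintype ι] [DecidableEq ι] where
  /-- the interaction `Q_A` -/
  Q : (A : Finset (Site d)) → Op A ι
  Q_hermitian : ∀ A, (Q A).IsHermitian
  Q_translate : ∀ (x : Site d) (A : Finset (Site d)) (σ τ : translate x A → ι),
    Q (translate x A) σ τ =
      Q A (fun a => σ ⟨a + x, add_mem_translate x a⟩) (fun a => τ ⟨a + x, add_mem_translate x a⟩)
  /-- the single-site unitary operators of the rotations -/
  rep : Matrix.specialOrthogonalGroup (Fin N) ℝ → Matrix.unitaryGroup ι ℂ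
  rep_mul : ∀ R S, ∃ c : ℂ, ‖c‖ = 1 ∧
    (rep (R * S) : Matrix ι ι ℂ) = c • ((rep R : Matrix ι ι ℂ) * (rep S : Matrix ι ι ℂ))
  rep_continuous : ∀ M : Matrix ι ι ℂ,
    Continuous fun R => (rep R : Matrix ι ι ℂ) * M * (rep R : Matrix ι ι ℂ)ᴴ
  Q_rotate : ∀ R (A : Finset (Site d)), (tensorPower A (rep R : Matrix ι ι ℂ))ᴴ * Q A *
    tensorPower A (rep R : Matrix ι ι ℂ) = Q A
  /-- the sites on which the vector operator attached to the origin acts -/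
  cluster : Finset (Site d)
  /-- the components of the vector operator attached to the origin -/
  lop : Fin N → Op cluster ι
  lop_hermitian : ∀ k, (lop k).IsHermitian
  lop_rotate : ∀ R (v : Vec N),
    tensorPower cluster (rep R : Matrix ι ι ℂ) * (∑ k, (v k : ℂ) • lop k) *
      (tensorPower cluster (rep R : Matrix ι ι ℂ))ᴴ = ∑ k, (rotate R v k : ℂ) • lop k

namespace SymmetricSystem

variable {d N : ℕ} {ι : Type*} [Fintype ι] [DecidableEq ι]

/-- `Q_A = 0` for all sets of large diameter. -/
def FiniteRange (S : SymmetricSystem d N ι) : Prop :=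
  ∃ r : ℝ, ∀ A : Finset (Site d), r < Metric.diam (A : Set (Site d)) → S.Q A = 0

/-- `∑_{A ∋ 0} (diam A)² |A| ‖Q_A‖ < ∞`. -/
def ShortRange (S : SymmetricSystem d N ι) : Prop :=
  Summable fun A : {A : Finset (Site d) // (0 : Site d) ∈ A} =>
    Metric.diam (A.1 : Set (Site d)) ^ 2 * (A.1.card : ℝ) * opNorm (S.Q A.1)

/-- The sites of the cube `[-K, K]^d` with periodic boundary conditions. -/
abbrev Torus (d K : ℕ) : Type := Fin d → ZMod (2 * K + 1)

/-- The map from the lattice to the periodic cube. -/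
def toTorus (d K : ℕ) (x : Site d) : Torus d K := fun i => (x i : ZMod (2 * K + 1))

/-- The interaction part of the periodic Hamiltonian: every finite nonempty `A`, up to translations
by multiples of the period, contributes once, with its sites mapped into the periodic cube. (For
such an `A` there are `|A|` pairs `x ∈ A'` with `x` in the cube and `A'` a translate of `A` by a
period, hence the weights.) A set two points of which are mapped to the same site does not
contribute. -/
def interaction (S : SymmetricSystem d N ι) (K : ℕ) : Op (Torus d K) ι :=
  ∑ x ∈ box d K, ∑' A : {A : Finset (Site d) // x ∈ A},
    ((A.1.card : ℂ))⁻¹ • embed (fun a : A.1 => toTorus d K a) (S.Q A.1)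

/-- The vector operator attached to `x`, in the periodic cube. -/
def lopAt (S : SymmetricSystem d N ι) (K : ℕ) (x : Site d) (k : Fin N) : Op (Torus d K) ι :=
  embed (fun a : S.cluster => toTorus d K (a + x)) (S.lop k)

/-- The Hamiltonian on `[-K, K]^d` with periodic boundary conditions, uniform field `h` and random
fields `η`, at disorder strength `ε`. -/
def hamiltonian (S : SymmetricSystem d N ι) (ε : ℝ) (K : ℕ) (h : Vec N) (η : Site d → Vec N) :
    Op (Torus d K) ι :=
  S.interaction K + ∑ x ∈ box d K, ∑ k, (((h + ε • η x) k : ℝ) : ℂ) • S.lopAt K x k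

end SymmetricSystem

/-- The free energy `-β⁻¹ log Tr e^{-βH}` for `0 < β < ∞`, and the ground state energy, that is
the lowest eigenvalue of `H`, for `β = ∞`. -/
def freeEnergy {X : Type*} [Fintype X] [DecidableEq X] (β : ENNReal) (H : Matrix X X ℂ) : ℝ :=
  if β = ⊤ then sInf (spectrum ℝ H)
  else -(1 / β.toReal) * Real.log (Matrix.trace (NormedSpace.exp (-(β.toReal : ℂ) • H))).re

/-- The field with the values in `[-L, L]^d` replaced by `0`. -/
def resetField {d N : ℕ} (L : ℕ) (η : Site d → Vec N) : Site d → Vec N :=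
  fun x => if x ∈ box d L then 0 else η x

/-- Independent, identically distributed random vectors in `ℝ^N` of finite variance, with a
rotation invariant distribution. -/
structure IsotropicDisorder {d N : ℕ} {Ω : Type*} [MeasurableSpace Ω] (P : Measure Ω)
    (η : Site d → Ω → Vec N) : Prop where
  measurable : ∀ x, Measurable (η x)
  indep : iIndepFun η P
  ident : ∀ x y, IdentDistrib (η x) (η y) P P
  rotation_invariant : ∀ (R : Matrix.specialOrthogonalGroup (Fin N) ℝ) (x : Site d),
    P.map (fun ω => rotate R (η x ω)) = P.map (η x)
  finite_variance : ∀ x, MemLp (η x) 2 P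

namespace SymmetricSystem

variable {d N : ℕ} {ι : Type*} [Fintype ι] [DecidableEq ι]

/-- `F_K^h(η)`, the free energy on `[-K, K]^d` with periodic boundary conditions. -/
def F (S : SymmetricSystem d N ι) (β : ENNReal) (ε : ℝ) (K : ℕ) (h : Vec N)
    (η : Site d → Vec N) : ℝ :=
  freeEnergy β (S.hamiltonian ε K h η)

/-- The finite volume free energy difference: half the conditional expectation of
`F_K^{δe}(η) - F_K^{δe}(r_L η) - F_K^{-δe}(η) + F_K^{-δe}(r_L η)`, given the components
`e · η_x` of the fields at the sites `x` of `[-L, L]^d`. -/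
def freeEnergyDifference (S : SymmetricSystem d N ι) {Ω : Type*} [MeasurableSpace Ω]
    (P : Measure Ω) (η : Site d → Ω → Vec N) (β : ENNReal) (ε : ℝ) (e : Vec N)
    (L K : ℕ) (δ : ℝ) : Ω → ℝ :=
  (1 / 2 : ℝ) •
    P[fun ω => S.F β ε K (δ • e) (fun x => η x ω)
        - S.F β ε K (δ • e) (resetField L fun x => η x ω)
        - S.F β ε K (-(δ • e)) (fun x => η x ω)
        + S.F β ε K (-(δ • e)) (resetField L fun x => η x ω)
      | MeasurableSpace.comap (fun ω (x : box d L) => (inner ℝ e (η x ω) : ℝ)) inferInstance]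

/-- `G` is the limit, first `j → ∞` and then `i → ∞`, of the centred finite volume free energy
differences in the cubes `[-K_j, K_j]^d` with the fields `±δ_i e`, for almost all values of the
disorder. -/
def IsLimitFreeEnergyDifference (S : SymmetricSystem d N ι) {Ω : Type*} [MeasurableSpace Ω]
    (P : Measure Ω) (η : Site d → Ω → Vec N) (β : ENNReal) (ε : ℝ) (e : Vec N)
    (δ : ℕ → ℝ) (K : ℕ → ℕ) (L : ℕ) (G : Ω → ℝ) : Prop :=
  ∃ g : ℕ → Ω → ℝ, ∀ᵐ ω ∂P,
    (∀ i, Tendsto (fun j => S.freeEnergyDifference P η β ε e L (K j) (δ i) ω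
        - ∫ ω', S.freeEnergyDifference P η β ε e L (K j) (δ i) ω' ∂P) atTop (𝓝 (g i ω))) ∧
    Tendsto (fun i => g i ω) atTop (𝓝 (G ω))

end SymmetricSystem

end QuantumImryMa

end

noncomputable section

namespace QuantumImryMa

/-! ### Free energies: Peierls' inequality, approximate concavity, unitary invariance. -/

section FreeEnergy

open scoped Matrix.Norms.L2Operator

variable {X : Type*} [Fintype X] [DecidableEq X]

/-! The mechanism is a Mermin–Wagner spin wave, applied to free energies instead of states. Choose a
plane containing `e` and rotate the spin at each site in this plane by an angle `θ` which is `0` on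
and near `[-L, L]^d`, equals `π` beyond a distance of about `2L`, and has slope at most `π / L`
(`exists_angle`). Let the field at each site be rotated by the same angle. Conjugation by the
product of the spin rotations does not change a free energy (`freeEnergy_conj`), so the only cost is
the failure of the Hamiltonian to be covariant under rotations that vary from site to site.

This cost is of second order in the slope, because the rotations by `θ` and by `-θ` are averaged:
for a unitary `W` close to `1`, the mean of `Wᴴ * M * W` and `W * M * Wᴴ` differs from `M` by a
multiple of `‖W - 1‖ ^ 2` (`norm_conj_add_conj_le`). As each `Q_A` is rotation invariant, only the
variation of `θ` over `A` matters, and the short range condition bounds the total by a multiple of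
`L^d * (1 / L)^2` (`norm_deformation_interaction_le`). Approximate midpoint concavity of the free
energy (`freeEnergy_midpoint_le`) turns this operator estimate into an upper bound for the average
of the two free energies with rotated fields (`exists_rotation_bound`).

Where `θ = π`, both rotations turn the uniform field `-δe` into `δe`; the remaining `O(L^d)` sites
cost `O(L^d |δ|)`, which disappears as `δ → 0` (`exists_flip_bound`). The random fields are rotated
too, but only off `[-L, L]^d`, and isotropy makes this invisible to conditional expectations given
the components in that cube (`condExp_rotated`). The error from the field operators contains norms
of random fields off the cube; these are independent of the conditioning and average to a constant.
Hence the conditional free energies in the fields `δe` and `-δe` differ by `O(L^(d-2) + L^d |δ|)`,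
both for `η` and for the field reset to `0` in the cube, and the lemma follows in the limit. -/

lemma diag_conj_diagonal (W : Matrix X X ℂ) (l : X → ℝ) (i : X) :
    ((W * diagonal (fun j => (l j : ℂ)) * Wᴴ) i i).re = ∑ j, ‖W i j‖ ^ 2 * l j := by
  rw [Matrix.mul_apply, Complex.re_sum]
  refine Finset.sum_congr rfl fun j _ => ?_
  rw [Matrix.mul_diagonal, Matrix.conjTranspose_apply]
  have : W i j * (l j : ℂ) * star (W i j) = ((‖W i j‖ ^ 2 * l j : ℝ) : ℂ) := by
    rw [mul_right_comm]
    have := Complex.mul_conj' (W i j)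
    simp only [RCLike.star_def] at *
    rw [this]; push_cast; ring
  rw [this, Complex.ofReal_re]

lemma sum_norm_sq_row {W : Matrix X X ℂ} (hW : W * Wᴴ = 1) (i : X) :
    ∑ j, ‖W i j‖ ^ 2 = 1 := by
  have h := diag_conj_diagonal W (fun _ => 1) i
  simpa [hW] using h.symm

lemma sum_norm_sq_col {W : Matrix X X ℂ} (hW : Wᴴ * W = 1) (j : X) :
    ∑ i, ‖W i j‖ ^ 2 = 1 := by
  have h := sum_norm_sq_row (W := Wᴴ) (by simpa using hW) j
  simpa using h

/-- The diagonal entries of a matrix in the orthonormal basis given by the columns of `V`. -/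
def diagIn (V A : Matrix X X ℂ) (i : X) : ℝ := ((Vᴴ * A * V) i i).re

lemma abs_diagIn_le {V : Matrix X X ℂ} (hV : V ∈ unitaryGroup X ℂ) (A : Matrix X X ℂ) (i : X) :
    |diagIn V A i| ≤ ‖A‖ := by
  have h1 : ‖Vᴴ * A * V‖ = ‖A‖ := by
    rw [CStarRing.norm_mul_mem_unitary _ hV]
    exact CStarRing.norm_mem_unitary_mul _ (Unitary.star_mem hV)
  have h2 : ‖(Vᴴ * A * V) i i‖ ≤ ‖Vᴴ * A * V‖ := by
    have := l2_opNorm_mulVec (Vᴴ * A * V) (EuclideanSpace.single i 1)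
    have h3 := PiLp.norm_apply_le
      ((EuclideanSpace.equiv X ℂ).symm ((Vᴴ * A * V) *ᵥ (EuclideanSpace.single i (1 : ℂ)))) i
    simp at this h3
    exact h3.trans this
  exact (Complex.abs_re_le_norm _).trans (h2.trans h1.le)

lemma exists_diagonalization {A : Matrix X X ℂ} (hA : A.IsHermitian) :
    ∃ U ∈ unitaryGroup X ℂ, ∃ l : X → ℝ, A = U * diagonal (fun j => (l j : ℂ)) * Uᴴ ∧
      spectrum ℝ A = Set.range l := by
  refine ⟨hA.eigenvectorUnitary, hA.eigenvectorUnitary.2, hA.eigenvalues, ?_,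
    hA.spectrum_real_eq_range_eigenvalues⟩
  conv_lhs => rw [hA.spectral_theorem]
  rfl

lemma trace_exp_conj_diagonal {U : Matrix X X ℂ} (hU : U ∈ unitaryGroup X ℂ) (l : X → ℝ) (b : ℝ) :
    (trace (NormedSpace.exp (-(b : ℂ) • (U * diagonal (fun j => (l j : ℂ)) * Uᴴ)))).re =
      ∑ j, Real.exp (-b * l j) := by
  have h1 : U * Uᴴ = 1 := Unitary.mul_star_self_of_mem hU
  have h2 : Uᴴ * U = 1 := Unitary.star_mul_self_of_mem hU
  have hinv : U⁻¹ = Uᴴ := Matrix.inv_eq_right_inv h1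
  have hu : IsUnit U := (Units.mk U Uᴴ h1 h2).isUnit
  have : -(b : ℂ) • (U * diagonal (fun j => (l j : ℂ)) * Uᴴ) =
      U * diagonal (fun j => -(b : ℂ) * (l j : ℂ)) * U⁻¹ := by
    rw [hinv, ← Matrix.smul_mul, ← Matrix.mul_smul, ← Matrix.diagonal_smul]; rfl
  rw [this, Matrix.exp_conj _ _ hu, Matrix.trace_mul_cycle, hinv, h2, one_mul, Matrix.exp_diagonal,
    Matrix.trace_diagonal, Complex.re_sum]
  refine Finset.sum_congr rfl fun j _ => ?_
  rw [Pi.coe_exp]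
  rw [← Complex.exp_eq_exp_ℂ]
  rw [show -(b : ℂ) * (l j : ℂ) = ((-b * l j : ℝ) : ℂ) by push_cast; ring, Complex.exp_ofReal_re]

lemma diagIn_eq {V U : Matrix X X ℂ} (l : X → ℝ) (i : X) :
    diagIn V (U * diagonal (fun j => (l j : ℂ)) * Uᴴ) i = ∑ j, ‖(Vᴴ * U) i j‖ ^ 2 * l j := by
  rw [← diag_conj_diagonal, diagIn]
  simp [Matrix.mul_assoc, Matrix.conjTranspose_mul]

/-- Peierls' inequality. -/
lemma sum_exp_diagIn_le {A V : Matrix X X ℂ} (hA : A.IsHermitian) (hV : V ∈ unitaryGroup X ℂ)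
    (b : ℝ) :
    ∑ i, Real.exp (-b * diagIn V A i) ≤ (trace (NormedSpace.exp (-(b : ℂ) • A))).re := by
  obtain ⟨U, hU, l, rfl, -⟩ := exists_diagonalization hA
  have hW : Vᴴ * U ∈ unitaryGroup X ℂ := mul_mem (Unitary.star_mem hV) hU
  have h1 := sum_norm_sq_row (Unitary.mul_star_self_of_mem hW)
  have h2 := sum_norm_sq_col (Unitary.star_mul_self_of_mem hW)
  rw [trace_exp_conj_diagonal hU]
  -- The diagonal entries of `A` are averages of its eigenvalues with weights `‖(Vᴴ * U) i j‖ ^ 2`.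
  -- These weights form a doubly stochastic matrix: the row sums allow Jensen's inequality, the
  -- column sums collapse the result.
  calc ∑ i, Real.exp (-b * diagIn V _ i)
      ≤ ∑ i, ∑ j, ‖(Vᴴ * U) i j‖ ^ 2 * Real.exp (-b * l j) := by
        refine Finset.sum_le_sum fun i _ => ?_
        have := convexOn_exp.map_sum_le (t := Finset.univ) (w := fun j => ‖(Vᴴ * U) i j‖ ^ 2)
          (p := fun j => -b * l j) (fun _ _ => by positivity) (h1 i) (fun _ _ => Set.mem_univ _)
        simp only [smul_eq_mul] at this
        refine le_trans (le_of_eq ?_) this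
        rw [diagIn_eq, Finset.mul_sum]
        congr 1
        exact Finset.sum_congr rfl fun j _ => by ring
    _ = ∑ j, Real.exp (-b * l j) := by
        rw [Finset.sum_comm]
        simp_rw [← Finset.sum_mul, h2, one_mul]

lemma sInf_spectrum_le_diagIn {A V : Matrix X X ℂ} (hA : A.IsHermitian)
    (hV : V ∈ unitaryGroup X ℂ) (i : X) : sInf (spectrum ℝ A) ≤ diagIn V A i := by
  obtain ⟨U, hU, l, rfl, hs⟩ := exists_diagonalization hA
  have hW : Vᴴ * U ∈ unitaryGroup X ℂ := mul_mem (Unitary.star_mem hV) hU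
  have h1 := sum_norm_sq_row (Unitary.mul_star_self_of_mem hW)
  rw [hs, diagIn_eq, ← one_mul (sInf _), ← h1 i, Finset.sum_mul]
  refine Finset.sum_le_sum fun j _ => mul_le_mul_of_nonneg_left ?_ (by positivity)
  exact csInf_le (Set.finite_range l).bddBelow (Set.mem_range_self j)

lemma diagIn_self {U : Matrix X X ℂ} (hU : U ∈ unitaryGroup X ℂ) (l : X → ℝ) (i : X) :
    diagIn U (U * diagonal (fun j => (l j : ℂ)) * Uᴴ) i = l i := by
  have h2 : Uᴴ * U = 1 := Unitary.star_mul_self_of_mem hU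
  rw [diagIn_eq, h2]
  simp [Matrix.one_apply, apply_ite, ite_pow]

lemma diagIn_midpoint_le {V : Matrix X X ℂ} (hV : V ∈ unitaryGroup X ℂ) {A B H : Matrix X X ℂ}
    {c : ℝ} (h : ‖(1 / 2 : ℂ) • (A + B) - H‖ ≤ c) (i : X) :
    (diagIn V A i + diagIn V B i) / 2 ≤ diagIn V H i + c := by
  have h1 := (le_abs_self _).trans ((abs_diagIn_le hV _ i).trans h)
  have h2 : diagIn V ((1 / 2 : ℂ) • (A + B) - H) i =
      (diagIn V A i + diagIn V B i) / 2 - diagIn V H i := by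
    have h3 : ∀ z : ℂ, ((2 : ℂ)⁻¹ * z).re = z.re / 2 := fun z => by
      rw [show (2 : ℂ)⁻¹ = ((2⁻¹ : ℝ) : ℂ) by push_cast; rfl, Complex.re_ofReal_mul]; ring
    simp only [diagIn, Matrix.mul_sub, Matrix.sub_mul, Matrix.mul_smul, Matrix.smul_mul,
      Matrix.mul_add, Matrix.add_mul, Matrix.sub_apply, Matrix.smul_apply, Matrix.add_apply,
      Complex.sub_re, smul_eq_mul, one_div, h3, Complex.add_re]
  linarith

/-- Concavity and norm continuity in one statement. In an eigenbasis of `H` the mean of the diagonal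
entries of `A` and `B` exceeds the eigenvalue of `H` by at most `c`. For `β = ⊤` the variational
principle at the lowest eigenvalue of `H` concludes; otherwise Peierls' inequality bounds the
partition functions of `A` and `B` from below by their diagonal sums. -/
lemma freeEnergy_midpoint_le [Nonempty X] {β : ENNReal} (hβ : β ≠ 0) {A B H : Matrix X X ℂ}
    (hA : A.IsHermitian) (hB : B.IsHermitian) (hH : H.IsHermitian) {c : ℝ}
    (h : ‖(1 / 2 : ℂ) • (A + B) - H‖ ≤ c) :
    (freeEnergy β A + freeEnergy β B) / 2 ≤ freeEnergy β H + c := by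
  obtain ⟨U, hU, l, rfl, hs⟩ := exists_diagonalization hH
  have hm := fun i => diagIn_midpoint_le hU h i
  simp only [diagIn_self hU] at hm
  unfold freeEnergy
  split_ifs with hβt
  · rw [hs]
    obtain ⟨i, hi⟩ : sInf (Set.range l) ∈ Set.range l :=
      (Set.range_nonempty l).csInf_mem (Set.finite_range l)
    rw [← hi]
    have h1 := sInf_spectrum_le_diagIn hA hU i
    have h2 := sInf_spectrum_le_diagIn hB hU i
    linarith [hm i]
  · set b := β.toReal with hb
    have hb0 : 0 < b := ENNReal.toReal_pos hβ hβt
    rw [trace_exp_conj_diagonal hU]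
    have hA1 := sum_exp_diagIn_le hA hU b
    have hB1 := sum_exp_diagIn_le hB hU b
    set ZA := (trace (NormedSpace.exp (-(b : ℂ) • A))).re
    set ZB := (trace (NormedSpace.exp (-(b : ℂ) • B))).re
    have pos : ∀ f : X → ℝ, 0 < ∑ i, Real.exp (f i) := fun f =>
      Finset.sum_pos (fun i _ => Real.exp_pos _) Finset.univ_nonempty
    have hZA : 0 < ZA := (pos _).trans_le hA1
    have hZB : 0 < ZB := (pos _).trans_le hB1
    set Z := ∑ j, Real.exp (-b * l j) with hZ
    have hZ0 : 0 < Z := pos _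
    -- Cauchy–Schwarz separates the diagonal entries of `A` and `B`, so that the partition function
    -- of `H` is at most `exp (b * c)` times the geometric mean of those of `A` and `B`.
    have key : Z ^ 2 ≤ Real.exp (b * c) ^ 2 * (ZA * ZB) := by
      have h1 : Z ≤ Real.exp (b * c) * ∑ i, Real.exp (-b * diagIn U A i / 2) *
          Real.exp (-b * diagIn U B i / 2) := by
        rw [Finset.mul_sum]
        refine Finset.sum_le_sum fun i _ => ?_
        rw [← Real.exp_add, ← Real.exp_add, Real.exp_le_exp]
        nlinarith [hm i]
      have h2 : (∑ i, Real.exp (-b * diagIn U A i / 2) * Real.exp (-b * diagIn U B i / 2)) ^ 2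
          ≤ ZA * ZB := by
        refine (Finset.sum_mul_sq_le_sq_mul_sq _ _ _).trans ?_
        simp_rw [← Real.exp_nat_mul, Nat.cast_ofNat, mul_div_cancel₀ _ (two_ne_zero' ℝ)]
        exact mul_le_mul hA1 hB1 (pos _).le hZA.le
      calc Z ^ 2 ≤ (Real.exp (b * c) * ∑ i, Real.exp (-b * diagIn U A i / 2) *
          Real.exp (-b * diagIn U B i / 2)) ^ 2 := pow_le_pow_left₀ hZ0.le h1 2
        _ = Real.exp (b * c) ^ 2 * (∑ i, Real.exp (-b * diagIn U A i / 2) *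
          Real.exp (-b * diagIn U B i / 2)) ^ 2 := mul_pow _ _ _
        _ ≤ _ := mul_le_mul_of_nonneg_left h2 (by positivity)
    have hlog := Real.log_le_log (by positivity) key
    rw [Real.log_pow, Real.log_mul (by positivity) (by positivity), Real.log_pow, Real.log_exp,
      Real.log_mul hZA.ne' hZB.ne'] at hlog
    push_cast at hlog
    have : Real.log Z ≤ b * c + (Real.log ZA + Real.log ZB) / 2 := by linarith
    have h3 := mul_le_mul_of_nonneg_left this (one_div_pos.2 hb0).le
    have h4 : 1 / b * (b * c) = c := by field_simp
    rw [mul_add, h4] at h3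
    linarith

/-- The case `A = B` of the midpoint inequality, used in both directions. -/
lemma abs_freeEnergy_sub_le [Nonempty X] {β : ENNReal} (hβ : β ≠ 0) {A H : Matrix X X ℂ}
    (hA : A.IsHermitian) (hH : H.IsHermitian) :
    |freeEnergy β A - freeEnergy β H| ≤ ‖A - H‖ := by
  have key : ∀ {A H : Matrix X X ℂ}, A.IsHermitian → H.IsHermitian →
      freeEnergy β A - freeEnergy β H ≤ ‖A - H‖ := fun {A H} hA hH => by
    have := freeEnergy_midpoint_le hβ hA hA hH (c := ‖A - H‖) (by
      rw [← two_smul ℂ A, smul_smul]; norm_num)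
    linarith
  rw [abs_le]
  have h1 := key hA hH
  have h2 := key hH hA
  rw [norm_sub_rev] at h2
  constructor <;> linarith

lemma freeEnergy_conj {U : Matrix X X ℂ} (hU : U ∈ unitaryGroup X ℂ) (β : ENNReal)
    (A : Matrix X X ℂ) : freeEnergy β (Uᴴ * A * U) = freeEnergy β A := by
  have h1 : U * Uᴴ = 1 := Unitary.mul_star_self_of_mem hU
  have h2 : Uᴴ * U = 1 := Unitary.star_mul_self_of_mem hU
  have hinv : U⁻¹ = Uᴴ := Matrix.inv_eq_right_inv h1
  unfold freeEnergy
  congr 1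
  · have := spectrum.units_conjugate' (R := ℝ) (a := A) (u := Units.mk U Uᴴ h1 h2)
    rw [← this]; rfl
  · have hs : -(β.toReal : ℂ) • (Uᴴ * A * U) = U⁻¹ * (-(β.toReal : ℂ) • A) * U := by
      rw [hinv, Matrix.mul_smul, Matrix.smul_mul]
    rw [hs, Matrix.exp_conj' _ _ (Units.mk U Uᴴ h1 h2).isUnit, hinv, Matrix.trace_mul_cycle, h1,
      one_mul]

end FreeEnergy

/-! ### Product operators, embeddings, and the second order estimate. -/

section TensorProducts

set_option linter.unusedSectionVars false

open scoped Matrix.Norms.L2Operator Kronecker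

variable {X Y ι : Type*} [Fintype X] [DecidableEq X] [Fintype Y] [DecidableEq Y]
  [Fintype ι] [DecidableEq ι]

/-- The tensor product `⊗_{x ∈ X} u_x` of single-site operators. -/
def prodOp (u : X → Matrix ι ι ℂ) : Op X ι := fun σ τ => ∏ x, u x (σ x) (τ x)

lemma prodOp_mul (u v : X → Matrix ι ι ℂ) :
    prodOp u * prodOp v = prodOp fun x => u x * v x := by
  ext σ τ
  simp only [prodOp, Matrix.mul_apply, Finset.prod_univ_sum, Fintype.piFinset_univ,
    Finset.prod_mul_distrib]

lemma prodOp_one : prodOp (fun _ : X => (1 : Matrix ι ι ℂ)) = 1 := by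
  ext σ τ
  rw [prodOp, Matrix.one_apply]
  split_ifs with h
  · subst h; exact Finset.prod_eq_one fun x _ => Matrix.one_apply_eq _
  · obtain ⟨x, hx⟩ := Function.ne_iff.1 h
    exact Finset.prod_eq_zero (Finset.mem_univ x) (Matrix.one_apply_ne hx)

lemma prodOp_conjTranspose (u : X → Matrix ι ι ℂ) :
    (prodOp u)ᴴ = prodOp fun x => (u x)ᴴ := by
  ext σ τ
  simp [prodOp, Matrix.conjTranspose_apply]

lemma prodOp_smul (c : X → ℂ) (u : X → Matrix ι ι ℂ) :
    prodOp (fun x => c x • u x) = (∏ x, c x) • prodOp u := by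
  ext σ τ
  simp [prodOp, Finset.prod_mul_distrib]

lemma prodOp_mem_unitaryGroup {u : X → Matrix ι ι ℂ} (hu : ∀ x, u x ∈ unitaryGroup ι ℂ) :
    prodOp u ∈ unitaryGroup (X → ι) ℂ := by
  rw [Matrix.mem_unitaryGroup_iff, Matrix.star_eq_conjTranspose, prodOp_conjTranspose, prodOp_mul]
  rw [← prodOp_one]
  congr 1
  ext1 x
  exact Unitary.mul_star_self_of_mem (hu x)

/-- The operator `M` at the site `x`. -/
def siteOp (x : X) (M : Matrix ι ι ℂ) : Op X ι := prodOp (Function.update (fun _ => 1) x M)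

lemma siteOp_apply (x : X) (M : Matrix ι ι ℂ) (σ τ : X → ι) :
    siteOp x M σ τ =
      M (σ x) (τ x) * ∏ y ∈ Finset.univ.erase x, (1 : Matrix ι ι ℂ) (σ y) (τ y) := by
  rw [siteOp, prodOp, ← Finset.mul_prod_erase _ _ (Finset.mem_univ x), Function.update_self]
  congr 1
  exact Finset.prod_congr rfl fun y hy => by
    rw [Function.update_of_ne (Finset.ne_of_mem_erase hy)]

/-- `siteOp x` as a homomorphism of star algebras. -/
def siteHom (x : X) : Matrix ι ι ℂ →⋆ₙₐ[ℂ] Op X ι where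
  toFun := siteOp x
  map_smul' c M := by ext σ τ; simp [siteOp_apply, mul_assoc]
  map_zero' := by ext σ τ; simp [siteOp_apply]
  map_add' M M' := by ext σ τ; simp [siteOp_apply, add_mul]
  map_mul' M M' := by
    rw [siteOp, siteOp, siteOp, prodOp_mul]
    congr 1; ext1 y
    rcases eq_or_ne y x with rfl | h <;> simp [*]
  map_star' M := by
    rw [siteOp, siteOp, Matrix.star_eq_conjTranspose, Matrix.star_eq_conjTranspose,
      prodOp_conjTranspose]
    congr 1; ext1 y
    rcases eq_or_ne y x with rfl | h <;> simp [*]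

/-- Telescoping: switching on one factor multiplies a unitary by a single-site operator, and
`siteHom`, being a star homomorphism, is contractive. So each site contributes at most `‖w x - 1‖`.
-/
lemma norm_prodOp_sub_one_le {w : X → Matrix ι ι ℂ} (hw : ∀ x, w x ∈ unitaryGroup ι ℂ) :
    ‖prodOp w - 1‖ ≤ ∑ x, ‖w x - 1‖ := by
  have key : ∀ s : Finset X, ‖prodOp (fun x => if x ∈ s then w x else 1) - 1‖ ≤
      ∑ x ∈ s, ‖w x - 1‖ := by
    intro s
    induction s using Finset.induction_on with
    | empty => simp [prodOp_one]
    | insert a s ha ih =>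
      have h1 : prodOp (fun x => if x ∈ insert a s then w x else 1) =
          prodOp (fun x => if x ∈ s then w x else 1) * siteOp a (w a) := by
        rw [siteOp, prodOp_mul]
        congr 1; ext1 y
        rcases eq_or_ne y a with rfl | h
        · simp [ha]
        · simp [h]
      have h2 : siteOp a (w a) - 1 = siteHom a (w a - 1) := by
        rw [map_sub]
        congr 1
        change (1 : Op X ι) = siteOp a 1
        rw [siteOp, Function.update_eq_self, prodOp_one]
      have hP : prodOp (fun x => if x ∈ s then w x else 1) ∈ unitaryGroup (X → ι) ℂ :=
        prodOp_mem_unitaryGroup fun x => by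
          split_ifs
          · exact hw x
          · exact one_mem _
      have h3 : prodOp (fun x => if x ∈ insert a s then w x else 1) - 1 =
          prodOp (fun x => if x ∈ s then w x else 1) * siteHom a (w a - 1) +
            (prodOp (fun x => if x ∈ s then w x else 1) - 1) := by
        rw [h1, ← h2, mul_sub, mul_one]; abel
      rw [h3, Finset.sum_insert ha]
      refine (norm_add_le _ _).trans (add_le_add ?_ ih)
      rw [CStarRing.norm_mem_unitary_mul _ hP]
      exact NonUnitalStarAlgHom.norm_apply_le _ _
  simpa using key Finset.univ

lemma embed_of_not_injective {f : X → Y} (hf : ¬ Function.Injective f) (M : Op X ι) :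
    embed f M = 0 := by
  ext σ τ
  simp [embed, hf]

open Classical in
/-- Splits a configuration into its part on the range of `f` and its part off the range. -/
def splitConfig {f : X → Y} (hf : Function.Injective f) :
    (Y → ι) ≃ (X → ι) × ({y // ¬ y ∈ Set.range f} → ι) :=
  (Equiv.piEquivPiSubtypeProd (fun y => y ∈ Set.range f) fun _ => ι).trans
    (((Equiv.ofInjective f hf).symm.arrowCongr (Equiv.refl ι)).prodCongr (Equiv.refl _))

lemma splitConfig_apply {f : X → Y} (hf : Function.Injective f) (σ : Y → ι) :
    splitConfig hf σ =
    (σ ∘ f, fun y : {y // ¬ y ∈ Set.range f} => σ y) := rfl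

-- In the form `M ⊗ 1` an injective embedding inherits multiplicativity and compatibility with
-- adjoints from the Kronecker product.
open Classical in
lemma embed_eq_kronecker {f : X → Y} (hf : Function.Injective f) (M : Op X ι) :
    embed f M = (M ⊗ₖ (1 : Op {y // ¬ y ∈ Set.range f} ι)).submatrix (splitConfig hf)
      (splitConfig hf) := by
  ext σ τ
  rw [Matrix.submatrix_apply, Matrix.kronecker_apply, splitConfig_apply, splitConfig_apply, embed,
    Matrix.one_apply]
  by_cases h : ∀ y, y ∉ Set.range f → σ y = τ y
  · rw [if_pos ⟨hf, h⟩, if_pos, mul_one]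
    ext1 y
    exact h y y.2
  · rw [if_neg fun H => h H.2, if_neg, mul_zero]
    intro H
    exact h fun y hy => congrFun H ⟨y, hy⟩

open Classical in
lemma prodOp_eq_kronecker {f : X → Y} (hf : Function.Injective f) (u : Y → Matrix ι ι ℂ) :
    prodOp u = (prodOp (fun x => u (f x)) ⊗ₖ
      prodOp (fun y : {y // ¬ y ∈ Set.range f} => u y)).submatrix (splitConfig hf)
      (splitConfig hf) := by
  ext σ τ
  rw [Matrix.submatrix_apply, Matrix.kronecker_apply, splitConfig_apply, splitConfig_apply]
  simp only [prodOp, Function.comp]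
  rw [← Fintype.prod_subtype_mul_prod_subtype (fun y => y ∈ Set.range f)]
  congr 1
  convert ((Equiv.ofInjective f hf).prod_comp
    (fun y : {y // y ∈ Set.range f} => u y (σ y) (τ y))).symm <;> rfl

/-- `embed f` as a homomorphism of star algebras. -/
def embedHom {f : X → Y} (hf : Function.Injective f) : Op X ι →⋆ₙₐ[ℂ] Op Y ι where
  toFun := embed f
  map_smul' c M := by ext σ τ; simp [embed]
  map_zero' := by ext σ τ; simp [embed]
  map_add' M M' := by ext σ τ; simp only [embed, Matrix.add_apply]; split_ifs <;> simp
  map_mul' M M' := by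
    classical
    rw [embed_eq_kronecker hf, embed_eq_kronecker hf, embed_eq_kronecker hf,
      Matrix.submatrix_mul_equiv, ← Matrix.mul_kronecker_mul, one_mul]
  map_star' M := by
    classical
    rw [embed_eq_kronecker hf, embed_eq_kronecker hf, Matrix.star_eq_conjTranspose,
      Matrix.star_eq_conjTranspose, Matrix.conjTranspose_submatrix, Matrix.conjTranspose_kronecker,
      Matrix.conjTranspose_one]

/-- Star homomorphisms of C⋆-algebras are contractive; a non-injective `f` gives `0`. -/
lemma norm_embed_le (f : X → Y) (M : Op X ι) : ‖embed f M‖ ≤ ‖M‖ := by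
  by_cases hf : Function.Injective f
  · exact NonUnitalStarAlgHom.norm_apply_le (embedHom hf) M
  · rw [embed_of_not_injective hf, norm_zero]; exact norm_nonneg _

/-- `embed f` as a linear map. -/
def embedLin (f : X → Y) : Op X ι →ₗ[ℂ] Op Y ι where
  toFun := embed f
  map_smul' c M := by ext σ τ; simp [embed]
  map_add' M M' := by ext σ τ; simp only [embed, Matrix.add_apply]; split_ifs <;> simp

lemma embed_isHermitian (f : X → Y) {M : Op X ι} (hM : M.IsHermitian) :
    (embed f M).IsHermitian := by
  by_cases hf : Function.Injective f
  · have := map_star (embedHom (ι := ι) hf) M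
    rw [Matrix.star_eq_conjTranspose, hM.eq] at this
    exact this.symm
  · rw [embed_of_not_injective hf]; exact Matrix.isHermitian_zero

/-- The factors off the range of `f` commute with `M ⊗ 1` and cancel by unitarity. -/
lemma prodOp_conj_embed {f : X → Y} {u : Y → Matrix ι ι ℂ}
    (hu : ∀ y, u y ∈ unitaryGroup ι ℂ) (M : Op X ι) :
    (prodOp u)ᴴ * embed f M * prodOp u =
      embed f ((prodOp fun x => u (f x))ᴴ * M * prodOp fun x => u (f x)) := by
  classical
  by_cases hf : Function.Injective f
  · rw [embed_eq_kronecker hf, embed_eq_kronecker hf, prodOp_eq_kronecker hf,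
      Matrix.conjTranspose_submatrix, Matrix.conjTranspose_kronecker, Matrix.submatrix_mul_equiv,
      Matrix.submatrix_mul_equiv, ← Matrix.mul_kronecker_mul, ← Matrix.mul_kronecker_mul, mul_one]
    congr 2
    exact Unitary.star_mul_self_of_mem
      (prodOp_mem_unitaryGroup fun y : {y // ¬ y ∈ Set.range f} => hu y)
  · rw [embed_of_not_injective hf, embed_of_not_injective hf, mul_zero, zero_mul]

/-- The second order estimate for the deformation of an operator by a unitary operator and its
inverse. -/
lemma norm_conj_add_conj_le {n : Type*} [Fintype n] [DecidableEq n] {W : Matrix n n ℂ}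
    (hW : W ∈ unitaryGroup n ℂ) (M : Matrix n n ℂ) :
    ‖(1 / 2 : ℂ) • (Wᴴ * M * W + W * M * Wᴴ) - M‖ ≤ 2 * ‖W - 1‖ ^ 2 * ‖M‖ := by
  have h1 : W * Wᴴ = 1 := Unitary.mul_star_self_of_mem hW
  set D := W - 1 with hD
  have hWD : W = 1 + D := by rw [hD]; abel
  -- Unitarity makes the first order term `Dᴴ + D` a second order quantity; in the symmetrized
  -- expression `D` enters to first order only through this sum.
  have hs : Dᴴ + D = -(D * Dᴴ) := by
    rw [hWD, Matrix.conjTranspose_add, Matrix.conjTranspose_one] at h1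
    have : (1 + D) * (1 + Dᴴ) = 1 + (Dᴴ + D + D * Dᴴ) := by noncomm_ring
    rw [this] at h1
    have h2 : Dᴴ + D + D * Dᴴ = 0 := by simpa using h1
    exact eq_neg_of_add_eq_zero_left h2
  have e1 : Wᴴ * M * W + W * M * Wᴴ =
      (2 : ℂ) • M + ((Dᴴ + D) * M + M * (Dᴴ + D) + Dᴴ * M * D + D * M * Dᴴ) := by
    rw [hWD, Matrix.conjTranspose_add, Matrix.conjTranspose_one, two_smul]
    noncomm_ring
  have e2 : (1 / 2 : ℂ) • (Wᴴ * M * W + W * M * Wᴴ) - M =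
      (1 / 2 : ℂ) • (-(D * Dᴴ) * M + M * -(D * Dᴴ) + Dᴴ * M * D + D * M * Dᴴ) := by
    rw [e1, hs, smul_add, smul_smul]; norm_num
  have hDs : ‖Dᴴ‖ = ‖D‖ := l2_opNorm_conjTranspose D
  have hb : ∀ A B C : Matrix n n ℂ, ‖A * B * C‖ ≤ ‖A‖ * ‖B‖ * ‖C‖ := fun A B C =>
    (norm_mul_le _ _).trans (mul_le_mul_of_nonneg_right (norm_mul_le _ _) (norm_nonneg _))
  have t1 : ‖-(D * Dᴴ) * M‖ ≤ ‖D‖ ^ 2 * ‖M‖ := by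
    rw [neg_mul, norm_neg]; refine (hb _ _ _).trans (le_of_eq ?_); rw [hDs]; ring
  have t2 : ‖M * -(D * Dᴴ)‖ ≤ ‖D‖ ^ 2 * ‖M‖ := by
    rw [mul_neg, norm_neg, ← mul_assoc]; refine (hb _ _ _).trans (le_of_eq ?_); rw [hDs]; ring
  have t3 : ‖Dᴴ * M * D‖ ≤ ‖D‖ ^ 2 * ‖M‖ := by
    refine (hb _ _ _).trans (le_of_eq ?_); rw [hDs]; ring
  have t4 : ‖D * M * Dᴴ‖ ≤ ‖D‖ ^ 2 * ‖M‖ := by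
    refine (hb _ _ _).trans (le_of_eq ?_); rw [hDs]; ring
  rw [e2, norm_smul]
  have := (norm_add_le (-(D * Dᴴ) * M + M * -(D * Dᴴ) + Dᴴ * M * D) (D * M * Dᴴ)).trans
    (add_le_add ((norm_add_le _ _).trans (add_le_add ((norm_add_le _ _).trans
      (add_le_add t1 t2)) t3)) t4)
  rw [show ‖(1 / 2 : ℂ)‖ = 1 / 2 by norm_num]
  linarith

end TensorProducts

/-! ### Rotations in a two-dimensional plane of `ℝ^N`. -/

section PlaneRotations

open scoped Matrix.Norms.L2Operator

/-- An oriented orthonormal pair of vectors in `ℝ^N`. -/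
structure Plane (N : ℕ) where
  /-- the first vector -/
  e : Fin N → ℝ
  /-- the second vector -/
  f : Fin N → ℝ
  ee : e ⬝ᵥ e = 1
  ff : f ⬝ᵥ f = 1
  ef : e ⬝ᵥ f = 0

namespace Plane

variable {N : ℕ} (p : Plane N)

/-- The generator of the rotations in the plane. -/
def gen : Matrix (Fin N) (Fin N) ℝ := vecMulVec p.f p.e - vecMulVec p.e p.f

/-- The orthogonal projection to the plane. -/
def proj : Matrix (Fin N) (Fin N) ℝ := vecMulVec p.e p.e + vecMulVec p.f p.f

lemma fe : p.f ⬝ᵥ p.e = 0 := by rw [dotProduct_comm]; exact p.ef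

lemma gen_mul_gen : p.gen * p.gen = -p.proj := by
  simp [gen, proj, mul_sub, sub_mul, vecMulVec_mul_vecMulVec, p.ee, p.ff, p.ef, p.fe]
  abel

lemma gen_mul_proj : p.gen * p.proj = p.gen := by
  simp [gen, proj, mul_add, sub_mul, vecMulVec_mul_vecMulVec, p.ee, p.ff, p.ef, p.fe]
  abel

lemma proj_mul_gen : p.proj * p.gen = p.gen := by
  simp [gen, proj, mul_sub, add_mul, vecMulVec_mul_vecMulVec, p.ee, p.ff, p.ef, p.fe]

lemma proj_mul_proj : p.proj * p.proj = p.proj := by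
  simp [proj, mul_add, add_mul, vecMulVec_mul_vecMulVec, p.ee, p.ff, p.ef, p.fe]

lemma gen_transpose : p.genᵀ = -p.gen := by
  simp [gen, transpose_vecMulVec]

lemma proj_transpose : p.projᵀ = p.proj := by
  simp [proj, transpose_vecMulVec]

/-- The matrix of the rotation by the angle `t` in the plane. -/
def rotMatrix (t : ℝ) : Matrix (Fin N) (Fin N) ℝ :=
  1 + Real.sin t • p.gen + (Real.cos t - 1) • p.proj

lemma rotMatrix_zero : p.rotMatrix 0 = 1 := by simp [rotMatrix]

lemma rotMatrix_add (s t : ℝ) : p.rotMatrix (s + t) = p.rotMatrix s * p.rotMatrix t := by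
  simp only [rotMatrix, add_mul, mul_add, one_mul, mul_one, Matrix.smul_mul, Matrix.mul_smul,
    gen_mul_gen, gen_mul_proj, proj_mul_gen, proj_mul_proj, Real.sin_add, Real.cos_add]
  module

lemma rotMatrix_transpose (t : ℝ) : (p.rotMatrix t)ᵀ = p.rotMatrix (-t) := by
  simp [rotMatrix, gen_transpose, proj_transpose]

lemma rotMatrix_mul_transpose (t : ℝ) : p.rotMatrix t * (p.rotMatrix t)ᵀ = 1 := by
  rw [rotMatrix_transpose, ← rotMatrix_add, add_neg_cancel, rotMatrix_zero]

/-- The rotation is the square of the rotation by half the angle, whose determinant has square `1`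
by orthogonality. -/
lemma rotMatrix_det (t : ℝ) : (p.rotMatrix t).det = 1 := by
  have h : (p.rotMatrix (t / 2)).det * (p.rotMatrix (t / 2)).det = 1 := by
    conv_lhs => rw [← Matrix.det_transpose (p.rotMatrix (t / 2)), Matrix.det_transpose]
    have := congrArg Matrix.det (p.rotMatrix_mul_transpose (t / 2))
    rwa [Matrix.det_mul, Matrix.det_transpose, Matrix.det_one] at this
  rw [← h, ← Matrix.det_mul, ← rotMatrix_add, add_halves]

/-- The rotation by the angle `t` in the plane. -/
def rot (t : ℝ) : Matrix.specialOrthogonalGroup (Fin N) ℝ :=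
  ⟨p.rotMatrix t, by
    rw [Matrix.mem_specialOrthogonalGroup_iff, Matrix.mem_orthogonalGroup_iff]
    exact ⟨p.rotMatrix_mul_transpose t, p.rotMatrix_det t⟩⟩

lemma rot_zero : p.rot 0 = 1 := Subtype.ext p.rotMatrix_zero

lemma rot_add (s t : ℝ) : p.rot (s + t) = p.rot s * p.rot t := Subtype.ext (p.rotMatrix_add s t)

lemma continuous_rot : Continuous p.rot := by
  refine Continuous.subtype_mk ?_ _
  unfold rotMatrix
  fun_prop

lemma norm_proj_le : ‖p.proj‖ ≤ 1 := by
  have h := l2_opNorm_conjTranspose_mul_self p.proj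
  rw [Matrix.conjTranspose_eq_transpose_of_trivial, proj_transpose, proj_mul_proj] at h
  by_contra! H
  nlinarith

lemma norm_gen_le : ‖p.gen‖ ≤ 1 := by
  have h := l2_opNorm_conjTranspose_mul_self p.gen
  rw [Matrix.conjTranspose_eq_transpose_of_trivial, gen_transpose, neg_mul, gen_mul_gen,
    neg_neg] at h
  have := p.norm_proj_le
  by_contra! H
  nlinarith

/-- The constant does not depend on the plane. This makes the final bound uniform in the direction
of the field. -/
lemma norm_rotMatrix_sub_one_le {t : ℝ} (ht : |t| ≤ 1) : ‖p.rotMatrix t - 1‖ ≤ 2 * |t| := by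
  have h1 : p.rotMatrix t - 1 = Real.sin t • p.gen + (Real.cos t - 1) • p.proj := by
    rw [rotMatrix]; abel
  have h2 : |Real.cos t - 1| ≤ |t| := by
    have h3 := Real.one_sub_sq_div_two_le_cos (x := t)
    have h4 := Real.cos_le_one t
    rw [abs_of_nonpos (by linarith)]
    have h5 : t ^ 2 = |t| * |t| := by rw [← sq, sq_abs]
    nlinarith [abs_nonneg t]
  have h3 : |Real.sin t| ≤ |t| := Real.abs_sin_le_abs
  rw [h1]
  refine (norm_add_le _ _).trans ?_
  rw [norm_smul, norm_smul, Real.norm_eq_abs, Real.norm_eq_abs]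
  nlinarith [p.norm_proj_le, p.norm_gen_le, norm_nonneg p.proj, norm_nonneg p.gen, abs_nonneg t,
    abs_nonneg (Real.sin t), abs_nonneg (Real.cos t - 1)]

lemma rotMatrix_pi_mulVec : p.rotMatrix Real.pi *ᵥ p.e = -p.e := by
  ext i
  simp [rotMatrix, proj, Matrix.add_mulVec, Matrix.smul_mulVec, vecMulVec_mulVec, p.ee, p.fe]
  ring

/-- Both signs are needed: the spin waves with angles `θ` and `-θ` must each reverse the uniform
field far away. -/
lemma rotMatrix_neg_pi_mulVec : p.rotMatrix (-Real.pi) *ᵥ p.e = -p.e := by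
  ext i
  simp [rotMatrix, proj, Matrix.add_mulVec, Matrix.smul_mulVec, vecMulVec_mulVec, p.ee, p.fe]
  ring

end Plane

/-- This is where `2 ≤ N` enters: there must be room for a direction orthogonal to `e`. -/
lemma exists_plane {N : ℕ} (hN : 2 ≤ N) {e : Vec N} (he : ‖e‖ = 1) :
    ∃ p : Plane N, p.e = e.ofLp := by
  have hfin : Module.finrank ℝ (Vec N) = N := by simp
  have : ∃ f : Vec N, f ≠ 0 ∧ inner ℝ e f = 0 := by
    have h1 : 0 < Module.finrank ℝ (Submodule.span ℝ {e})ᗮ := by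
      have h2 := (Submodule.span ℝ {e}).finrank_add_finrank_orthogonal
      have h3 : Module.finrank ℝ (Submodule.span ℝ {e}) ≤ 1 :=
        (finrank_span_singleton (norm_ne_zero_iff.1 (by rw [he]; exact one_ne_zero))).le
      omega
    obtain ⟨⟨f, hf⟩, hf0⟩ := Module.finrank_pos_iff_exists_ne_zero.1 h1
    refine ⟨f, fun h => hf0 (Subtype.ext h), ?_⟩
    exact (Submodule.mem_orthogonal _ _).1 hf e (Submodule.mem_span_singleton_self e)
  obtain ⟨f, hf0, hf⟩ := this
  have dot : ∀ v w : Vec N, v.ofLp ⬝ᵥ w.ofLp = inner ℝ v w := fun v w => by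
    rw [EuclideanSpace.inner_eq_star_dotProduct, dotProduct_comm]; rfl
  refine ⟨⟨e.ofLp, (‖f‖⁻¹ • f).ofLp, ?_, ?_, ?_⟩, rfl⟩
  · rw [dot, real_inner_self_eq_norm_sq, he]; norm_num
  · rw [dot, real_inner_self_eq_norm_sq, norm_smul, norm_inv, norm_norm,
      inv_mul_cancel₀ (norm_ne_zero_iff.2 hf0)]; norm_num
  · rw [dot, inner_smul_right, hf, mul_zero]

end PlaneRotations

/-! ### Lipschitz bounds for the single-spin rotations, up to phases. -/

section Phases

open scoped Matrix.Norms.L2Operator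

/-- A bounded one-parameter group which is near the identity for a short time is Lipschitz. -/
lemma norm_oneParameter_sub_one_le {A : Type*} [NormedRing A] [NormedAlgebra ℝ A] [CompleteSpace A]
    {α : ℝ → A} (hc : Continuous α) (hadd : ∀ s t, α (s + t) = α s * α t)
    (hb : ∀ s, ‖α s‖ ≤ 1) {a : ℝ} (ha : 0 < a) (hs : ∀ s, |s| ≤ a → ‖α s - 1‖ ≤ 1 / 2) (t : ℝ) :
    ‖α t - 1‖ ≤ 4 / a * |t| := by
  have hi : ∀ b c, IntervalIntegrable α volume b c := fun b c => hc.intervalIntegrable b c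
  -- `J` is within `a / 2` of `a • 1`, while by the group law `(α t - 1) * J` is a difference of two
  -- integrals over intervals of length `|t|`. Dividing out `J` approximately gives the Lipschitz
  -- bound without differentiating `α`.
  set J := ∫ s in (0 : ℝ)..a, α s with hJ
  have h1 : α t * J = ∫ s in t..t + a, α s := by
    have := (ContinuousLinearMap.mul ℝ A (α t)).intervalIntegral_comp_comm (hi 0 a)
    simp only [ContinuousLinearMap.mul_apply'] at this
    rw [hJ, ← this]
    simp_rw [← hadd]
    rw [intervalIntegral.integral_comp_add_left (f := α) t, add_zero]
  have h2 : (α t - 1) * J = (∫ s in t..0, α s) - ∫ s in t + a..a, α s := by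
    rw [sub_mul, one_mul, h1, hJ, intervalIntegral.integral_interval_sub_interval_comm (hi _ _)
      (hi _ _) (hi _ _)]
  have h3 : ‖(α t - 1) * J‖ ≤ 2 * |t| := by
    rw [h2]
    refine (norm_sub_le _ _).trans ?_
    have e1 := intervalIntegral.norm_integral_le_of_norm_le_const (a := t) (b := 0) (f := α) (C := 1)
      fun s _ => hb s
    have e2 := intervalIntegral.norm_integral_le_of_norm_le_const (a := t + a) (b := a) (f := α)
      (C := 1) fun s _ => hb s
    rw [zero_sub, abs_neg] at e1
    rw [show a - (t + a) = -t by ring, abs_neg] at e2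
    linarith
  have h4 : ‖J - a • (1 : A)‖ ≤ 1 / 2 * a := by
    have : J - a • (1 : A) = ∫ s in (0 : ℝ)..a, (α s - 1) := by
      rw [intervalIntegral.integral_sub (hi _ _) (by simp), intervalIntegral.integral_const,
        sub_zero]
    rw [this]
    have := intervalIntegral.norm_integral_le_of_norm_le_const (a := 0) (b := a)
      (f := fun s => α s - 1) (C := 1 / 2) fun s hs' => by
        rw [Set.uIoc_of_le ha.le] at hs'
        exact hs s (by rw [abs_of_pos hs'.1]; exact hs'.2)
    rwa [sub_zero, abs_of_pos ha] at this
  have h5 : a • (α t - 1) = (α t - 1) * J - (α t - 1) * (J - a • (1 : A)) := by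
    rw [← mul_sub, sub_sub_cancel, mul_smul_comm, mul_one]
  have h6 : a * ‖α t - 1‖ ≤ 2 * |t| + ‖α t - 1‖ * (1 / 2 * a) := by
    calc a * ‖α t - 1‖ = ‖a • (α t - 1)‖ := by rw [norm_smul, Real.norm_of_nonneg ha.le]
      _ ≤ ‖(α t - 1) * J‖ + ‖(α t - 1) * (J - a • (1 : A))‖ := by rw [h5]; exact norm_sub_le _ _
      _ ≤ _ := add_le_add h3 ((norm_mul_le _ _).trans
          (mul_le_mul_of_nonneg_left h4 (norm_nonneg _)))
  rw [div_mul_eq_mul_div, le_div_iff₀ ha]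
  linarith

lemma norm_oneParameter_clm_sub_one_le {V : Type*} [NormedAddCommGroup V] [NormedSpace ℂ V]
    [FiniteDimensional ℂ V] {α : ℝ → V →L[ℂ] V} (hc : ∀ v, Continuous fun t => α t v)
    (hadd : ∀ s t, α (s + t) = α s * α t) (hb : ∀ s, ‖α s‖ ≤ 1) {a : ℝ} (ha : 0 < a)
    (hs : ∀ s, |s| ≤ a → ‖α s - 1‖ ≤ 1 / 2) (t : ℝ) : ‖α t - 1‖ ≤ 4 / a * |t| :=
  haveI : CompleteSpace V := FiniteDimensional.complete ℂ V
  norm_oneParameter_sub_one_le (continuous_clm_apply.2 hc) hadd hb ha hs t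

variable {ι : Type*} [Fintype ι] [DecidableEq ι]

/-- Conjugation by a matrix. -/
def conjCLM (U : Matrix ι ι ℂ) : Matrix ι ι ℂ →L[ℂ] Matrix ι ι ℂ :=
  ContinuousLinearMap.mulLeftRight ℂ (Matrix ι ι ℂ) U Uᴴ

lemma conjCLM_apply (U M : Matrix ι ι ℂ) : conjCLM U M = U * M * Uᴴ := rfl

lemma norm_conjCLM_le {U : Matrix ι ι ℂ} (hU : U ∈ unitaryGroup ι ℂ) : ‖conjCLM U‖ ≤ 1 := by
  refine ContinuousLinearMap.opNorm_le_bound _ zero_le_one fun M => ?_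
  rw [conjCLM_apply, one_mul]
  refine le_of_eq ?_
  rw [← Matrix.star_eq_conjTranspose, CStarRing.norm_mul_mem_unitary _ (Unitary.star_mem hU),
    CStarRing.norm_mem_unitary_mul _ hU]

lemma norm_entry_le (M : Matrix ι ι ℂ) (i j : ι) : ‖M i j‖ ≤ ‖M‖ := by
  have := l2_opNorm_mulVec M (EuclideanSpace.single j 1)
  have h3 := PiLp.norm_apply_le
    ((EuclideanSpace.equiv ι ℂ).symm (M *ᵥ (EuclideanSpace.single j (1 : ℂ)))) i
  simp at this h3
  exact h3.trans this

/-- A unitary matrix whose conjugation is near the identity is near a phase. -/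
lemma exists_phase_norm_sub_one_le [Nonempty ι] :
    ∃ C : ℝ, 0 ≤ C ∧ ∀ U ∈ unitaryGroup ι ℂ,
      ∃ c : ℂ, ‖c‖ = 1 ∧ ‖c • U - 1‖ ≤ C * ‖conjCLM U - 1‖ := by
  obtain ⟨o⟩ := ‹Nonempty ι›
  have : Nontrivial (Matrix ι ι ℂ) := haveI : Nonempty ι := ⟨o⟩; inferInstance
  set K : ℝ := ∑ a : ι, ∑ b : ι, ‖Matrix.single b o (1 : ℂ)‖ * ‖Matrix.single a b (1 : ℂ)‖ with hK
  have hK0 : 0 ≤ K := by positivity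
  refine ⟨2 * K, by positivity, fun U hU => ?_⟩
  set ε := ‖conjCLM U - 1‖ with hε
  have hcomm : ∀ M : Matrix ι ι ℂ, ‖U * M - M * U‖ ≤ ε * ‖M‖ := fun M => by
    have h1 : U * M - M * U = (conjCLM U - 1) M * U := by
      rw [_root_.sub_apply, conjCLM_apply, one_apply_eq_self, sub_mul, mul_assoc _ Uᴴ U,
        show Uᴴ * U = 1 from Unitary.star_mul_self_of_mem hU, mul_one]
    rw [h1, CStarRing.norm_mul_mem_unitary _ hU]
    exact ContinuousLinearMap.le_opNorm _ _
  -- The `(a, o)` entry of the commutator of `U` with the matrix unit `single b o 1` is exactly the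
  -- `(a, b)` entry of `U - U o o • 1`; so near-commutation with matrix units makes `U` nearly
  -- scalar.
  have hentry : ∀ a b, ‖(U - U o o • (1 : Matrix ι ι ℂ)) a b‖ ≤ ε * ‖Matrix.single b o (1 : ℂ)‖ := by
    intro a b
    refine le_trans (le_of_eq ?_) ((norm_entry_le _ a o).trans (hcomm (Matrix.single b o 1)))
    congr 1
    rw [Matrix.sub_apply, Matrix.sub_apply, Matrix.mul_single_apply_same, Matrix.smul_apply]
    rcases eq_or_ne a b with rfl | h
    · simp
    · rw [Matrix.single_mul_apply_of_ne _ _ _ _ _ h, Matrix.one_apply_ne h]; simp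
  have hnear : ‖U - U o o • (1 : Matrix ι ι ℂ)‖ ≤ K * ε := by
    rw [Matrix.matrix_eq_sum_single (U - U o o • (1 : Matrix ι ι ℂ)), hK, Finset.sum_mul]
    refine (norm_sum_le _ _).trans (Finset.sum_le_sum fun a _ => ?_)
    rw [Finset.sum_mul]
    refine (norm_sum_le _ _).trans (Finset.sum_le_sum fun b _ => ?_)
    have : Matrix.single a b ((U - U o o • (1 : Matrix ι ι ℂ)) a b) =
        ((U - U o o • (1 : Matrix ι ι ℂ)) a b) • Matrix.single a b (1 : ℂ) := by
      rw [Matrix.smul_single, smul_eq_mul, mul_one]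
    rw [this, norm_smul]
    refine (mul_le_mul_of_nonneg_right (hentry a b) (norm_nonneg _)).trans (le_of_eq ?_)
    ring
  have hU1 : ‖U‖ = 1 := CStarRing.norm_of_mem_unitary hU
  have hdiff : |1 - ‖U o o‖| ≤ K * ε := by
    have := (abs_norm_sub_norm_le U (U o o • (1 : Matrix ι ι ℂ))).trans hnear
    rwa [hU1, norm_smul, CStarRing.norm_one, mul_one] at this
  -- If `U o o = 0`, then `1 ≤ K * ε`, and the trivial bound `2` suffices with phase `1`. Otherwise
  -- the phase is chosen to make `U o o` positive; the second `K * ε` in the constant pays for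
  -- replacing its modulus by `1`.
  rcases eq_or_ne (U o o) 0 with h0 | h0
  · refine ⟨1, norm_one, ?_⟩
    rw [h0, norm_zero, sub_zero, abs_one] at hdiff
    rw [one_smul]
    refine (norm_sub_le _ _).trans ?_
    rw [hU1, CStarRing.norm_one]
    linarith
  · have hn : ‖U o o‖ ≠ 0 := norm_ne_zero_iff.2 h0
    set c : ℂ := (‖U o o‖ : ℂ) / U o o with hc
    have hc1 : ‖c‖ = 1 := by
      rw [hc, norm_div, Complex.norm_real, norm_norm, div_self hn]
    refine ⟨c, hc1, ?_⟩
    have e : c • U - 1 = c • (U - U o o • (1 : Matrix ι ι ℂ)) +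
        ((‖U o o‖ : ℂ) - 1) • (1 : Matrix ι ι ℂ) := by
      rw [smul_sub, smul_smul, hc, div_mul_cancel₀ _ h0, sub_smul, one_smul]; abel
    rw [e]
    refine (norm_add_le _ _).trans ?_
    rw [norm_smul, norm_smul, hc1, CStarRing.norm_one, one_mul, mul_one]
    have : ‖(‖U o o‖ : ℂ) - 1‖ = |1 - ‖U o o‖| := by
      rw [← Complex.ofReal_one, ← Complex.ofReal_sub, Complex.norm_real, Real.norm_eq_abs,
        abs_sub_comm]
    rw [this]
    linarith

namespace SymmetricSystem

variable {d N : ℕ} (S : SymmetricSystem d N ι)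

lemma conjCLM_smul {c : ℂ} (hc : ‖c‖ = 1) (U : Matrix ι ι ℂ) : conjCLM (c • U) = conjCLM U := by
  ext1 M
  rw [conjCLM_apply, conjCLM_apply, Matrix.conjTranspose_smul, Matrix.smul_mul, Matrix.smul_mul,
    Matrix.mul_smul, smul_smul]
  have : c * star c = 1 := by
    have := Complex.mul_conj' c
    rw [hc] at this
    simpa using this
  rw [this, one_smul]

lemma conjCLM_mul (U V : Matrix ι ι ℂ) : conjCLM (U * V) = conjCLM U * conjCLM V := by
  ext1 M
  rw [mul_apply_eq_comp, conjCLM_apply, conjCLM_apply, conjCLM_apply,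
    Matrix.conjTranspose_mul]
  simp only [mul_assoc]

/-- Conjugation forgets phases, so the projective representation becomes a genuine one, and the
one-parameter group bound applies to it. -/
lemma conjCLM_rep_mul (R T : Matrix.specialOrthogonalGroup (Fin N) ℝ) :
    conjCLM (S.rep (R * T) : Matrix ι ι ℂ) = conjCLM (S.rep R : Matrix ι ι ℂ) *
      conjCLM (S.rep T : Matrix ι ι ℂ) := by
  obtain ⟨c, hc, h⟩ := S.rep_mul R T
  rw [h, conjCLM_smul hc, conjCLM_mul]

lemma conjCLM_rep_one : conjCLM (S.rep 1 : Matrix ι ι ℂ) = 1 := by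
  obtain ⟨c, hc, h⟩ := S.rep_mul 1 1
  rw [mul_one] at h
  have hU : (S.rep 1 : Matrix ι ι ℂ) ∈ unitaryGroup ι ℂ := (S.rep 1).2
  have h2 : (1 : Matrix ι ι ℂ) = c • (S.rep 1 : Matrix ι ι ℂ) := by
    have := congrArg (fun M => M * (S.rep 1 : Matrix ι ι ℂ)ᴴ) h
    simp only [Matrix.smul_mul, mul_assoc] at this
    rwa [show (S.rep 1 : Matrix ι ι ℂ) * (S.rep 1 : Matrix ι ι ℂ)ᴴ = 1 from
      Unitary.mul_star_self_of_mem hU, mul_one] at this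
  rw [← conjCLM_smul hc, ← h2]
  ext1 M
  simp [conjCLM_apply]

lemma continuous_conjCLM_rep :
    Continuous fun R : Matrix.specialOrthogonalGroup (Fin N) ℝ =>
      conjCLM (S.rep R : Matrix ι ι ℂ) :=
  continuous_clm_apply.2 fun M => S.rep_continuous M

/-- Uniformity in the plane: continuity on `SO(N)` gives a single neighbourhood of `1` where the
conjugation is within `1 / 2` of the identity, and it contains all rotations by sufficiently small
angles, in whatever plane. -/
lemma exists_conjCLM_lipschitz :
    ∃ C : ℝ, 0 ≤ C ∧ ∀ (p : Plane N) (t : ℝ),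
      ‖conjCLM (S.rep (p.rot t) : Matrix ι ι ℂ) - 1‖ ≤ C * |t| := by
  have hopen : IsOpen {R : Matrix.specialOrthogonalGroup (Fin N) ℝ |
      ‖conjCLM (S.rep R : Matrix ι ι ℂ) - 1‖ < 1 / 2} :=
    isOpen_lt (S.continuous_conjCLM_rep.sub continuous_const).norm continuous_const
  obtain ⟨O, hO, hO'⟩ := isOpen_induced_iff.1 hopen
  have h1 : (1 : Matrix (Fin N) (Fin N) ℝ) ∈ O := by
    have : (1 : Matrix.specialOrthogonalGroup (Fin N) ℝ) ∈ Subtype.val ⁻¹' O := by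
      rw [hO']
      simp [conjCLM_rep_one]
    exact this
  obtain ⟨ε, hε, hball⟩ := Metric.isOpen_iff.1 hO 1 h1
  -- For `|s| ≤ a` the bound `2 * |s|` on the distance of the rotation from `1` is valid and at most
  -- `ε / 2`.
  set a := min 1 (ε / 4) with ha
  have ha0 : 0 < a := by positivity
  refine ⟨4 / a, by positivity, fun p t => ?_⟩
  refine norm_oneParameter_clm_sub_one_le
    (α := fun t => conjCLM (S.rep (p.rot t) : Matrix ι ι ℂ))
    (fun M => (S.rep_continuous M).comp p.continuous_rot) (fun s t => ?_)
    (fun s => norm_conjCLM_le (S.rep _).2) ha0 (fun s hs => ?_) t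
  · simp only [p.rot_add, S.conjCLM_rep_mul]
  · have h2 : p.rot s ∈ Subtype.val ⁻¹' O := by
      refine hball ?_
      rw [Metric.mem_ball, dist_eq_norm]
      refine (p.norm_rotMatrix_sub_one_le (hs.trans (min_le_left _ _))).trans_lt ?_
      have := hs.trans (min_le_right _ _)
      linarith
    rw [hO'] at h2
    exact le_of_lt h2

lemma exists_phase_lipschitz [Nonempty ι] :
    ∃ C : ℝ, 0 ≤ C ∧ ∀ (p : Plane N) (t : ℝ), ∃ c : ℂ, ‖c‖ = 1 ∧
      ‖c • (S.rep (p.rot t) : Matrix ι ι ℂ) - 1‖ ≤ C * |t| := by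
  obtain ⟨C₁, h1, H1⟩ := exists_phase_norm_sub_one_le (ι := ι)
  obtain ⟨C₂, h2, H2⟩ := S.exists_conjCLM_lipschitz
  refine ⟨C₁ * C₂, by positivity, fun p t => ?_⟩
  obtain ⟨c, hc, h⟩ := H1 _ (S.rep (p.rot t)).2
  refine ⟨c, hc, h.trans ?_⟩
  rw [mul_assoc]
  exact mul_le_mul_of_nonneg_left (H2 p t) h1

end SymmetricSystem

end Phases

/-! ### Spin waves and their second order effect on local operators. -/

section Deformation

set_option linter.unusedSectionVars false

open scoped Matrix.Norms.L2Operator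

/-- Equality of matrices up to a phase. -/
def PhaseEq {n : Type*} (A B : Matrix n n ℂ) : Prop := ∃ c : ℂ, ‖c‖ = 1 ∧ A = c • B

namespace PhaseEq

variable {n : Type*} {A B C D : Matrix n n ℂ}

lemma symm (h : PhaseEq A B) : PhaseEq B A := by
  obtain ⟨c, hc, rfl⟩ := h
  refine ⟨c⁻¹, by rw [norm_inv, hc, inv_one], ?_⟩
  rw [smul_smul, inv_mul_cancel₀ (norm_ne_zero_iff.1 (by rw [hc]; exact one_ne_zero)), one_smul]

lemma trans (h : PhaseEq A B) (h' : PhaseEq B C) : PhaseEq A C := by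
  obtain ⟨c, hc, rfl⟩ := h
  obtain ⟨c', hc', rfl⟩ := h'
  exact ⟨c * c', by rw [norm_mul, hc, hc', one_mul], by rw [smul_smul]⟩

lemma conjTranspose (h : PhaseEq A B) : PhaseEq Aᴴ Bᴴ := by
  obtain ⟨c, hc, rfl⟩ := h
  exact ⟨star c, by rw [norm_star, hc], by rw [Matrix.conjTranspose_smul]⟩

lemma mul_left [Fintype n] (M : Matrix n n ℂ) (h : PhaseEq A B) : PhaseEq (M * A) (M * B) := by
  obtain ⟨c, hc, rfl⟩ := h
  exact ⟨c, hc, by rw [Matrix.mul_smul]⟩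

lemma conj_eq [Fintype n] (h : PhaseEq A B) (M : Matrix n n ℂ) : Aᴴ * M * A = Bᴴ * M * B := by
  obtain ⟨c, hc, rfl⟩ := h
  have : c * star c = 1 := by
    have := Complex.mul_conj' c
    rw [hc] at this
    simpa using this
  rw [Matrix.conjTranspose_smul, Matrix.smul_mul, Matrix.smul_mul, Matrix.mul_smul, smul_smul,
    mul_comm, this, one_smul]

lemma prodOp {X ι : Type*} [Fintype X] [DecidableEq X] [Fintype ι] [DecidableEq ι] {u v : X → Matrix ι ι ℂ} (h : ∀ x, PhaseEq (u x) (v x)) :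
    PhaseEq (prodOp u) (QuantumImryMa.prodOp v) := by
  choose c hc h using h
  refine ⟨∏ x, c x, by rw [norm_prod]; exact Finset.prod_eq_one fun x _ => hc x, ?_⟩
  rw [← prodOp_smul]
  congr 1
  ext1 x
  exact h x

end PhaseEq

namespace SymmetricSystem

variable {d N : ℕ} {ι : Type*} [Fintype ι] [DecidableEq ι] (S : SymmetricSystem d N ι)
  (p : Plane N)

lemma phaseEq_rep_add (s t : ℝ) : PhaseEq (S.rep (p.rot (s + t)) : Matrix ι ι ℂ)
    ((S.rep (p.rot s) : Matrix ι ι ℂ) * (S.rep (p.rot t) : Matrix ι ι ℂ)) := by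
  rw [p.rot_add]; exact S.rep_mul _ _

lemma rep_conjTranspose_mul_self (t : ℝ) :
    (S.rep (p.rot t) : Matrix ι ι ℂ)ᴴ * (S.rep (p.rot t) : Matrix ι ι ℂ) = 1 :=
  Unitary.star_mul_self_of_mem (S.rep (p.rot t)).2

lemma phaseEq_conjTranspose_mul (s t : ℝ) :
    PhaseEq ((S.rep (p.rot s) : Matrix ι ι ℂ)ᴴ * (S.rep (p.rot t) : Matrix ι ι ℂ))
      (S.rep (p.rot (t - s)) : Matrix ι ι ℂ) := by
  have h := (S.phaseEq_rep_add p s (t - s)).mul_left (S.rep (p.rot s) : Matrix ι ι ℂ)ᴴ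
  rwa [← mul_assoc, rep_conjTranspose_mul_self, one_mul, add_sub_cancel] at h

lemma phaseEq_rep_neg (t : ℝ) :
    PhaseEq (S.rep (p.rot (-t)) : Matrix ι ι ℂ) (S.rep (p.rot t) : Matrix ι ι ℂ)ᴴ := by
  have h1 := (S.phaseEq_conjTranspose_mul p t 0).symm
  have h2 := (S.phaseEq_conjTranspose_mul p 0 t).conjTranspose
  rw [Matrix.conjTranspose_mul, Matrix.conjTranspose_conjTranspose, sub_zero] at h2
  rw [zero_sub] at h1
  exact h1.trans h2

/-- The product of the rotations of the spins at the sites `x` by the angles `θ x`. -/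
def spinRot {X : Type*} [Fintype X] (θ : X → ℝ) : Op X ι :=
  prodOp fun x => (S.rep (p.rot (θ x)) : Matrix ι ι ℂ)

lemma spinRot_mem {X : Type*} [Fintype X] [DecidableEq X] (θ : X → ℝ) :
    S.spinRot p θ ∈ unitaryGroup (X → ι) ℂ := prodOp_mem_unitaryGroup fun _ => (S.rep _).2

lemma spinRot_const {X : Type*} [Fintype X] (t : ℝ) :
    S.spinRot p (fun _ : X => t) = tensorPower X (S.rep (p.rot t) : Matrix ι ι ℂ) := rfl

/-- `C` bounds the distance, up to phases, of the rotations of a single spin from the identity. -/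
def PhaseLipschitz (C : ℝ) : Prop :=
  0 ≤ C ∧ ∀ (p : Plane N) (t : ℝ), ∃ c : ℂ, ‖c‖ = 1 ∧
      ‖c • (S.rep (p.rot t) : Matrix ι ι ℂ) - 1‖ ≤ C * |t|

-- Undoing the rigid rotation by `t` leaves, up to a phase, the product `W` of the rotations by `θ x
-- - t`; with all angles reversed it leaves `Wᴴ`. So the symmetrized second order estimate applies,
-- with `‖W - 1‖ ≤ C * ∑ x, |θ x - t|`. The phases drop out under conjugation.
variable {S} in
lemma norm_deformed_sub_le {C : ℝ} (hC : S.PhaseLipschitz C) {X : Type*} [Fintype X]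
    [DecidableEq X] (θ : X → ℝ) (t : ℝ) (M : Op X ι) :
    ‖(1 / 2 : ℂ) • ((S.spinRot p θ)ᴴ * (S.spinRot p (fun _ => t) * M * (S.spinRot p fun _ => t)ᴴ) *
        S.spinRot p θ + (S.spinRot p (-θ))ᴴ * (S.spinRot p (fun _ => -t) * M *
        (S.spinRot p fun _ => -t)ᴴ) * S.spinRot p (-θ)) - M‖ ≤
      2 * (C * ∑ x, |θ x - t|) ^ 2 * ‖M‖ := by
  choose c hc h using fun x => hC.2 p (θ x - t)
  set w : X → Matrix ι ι ℂ := fun x => c x • (S.rep (p.rot (θ x - t)) : Matrix ι ι ℂ) with hw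
  have hwp : ∀ x, PhaseEq (w x) (S.rep (p.rot (θ x - t)) : Matrix ι ι ℂ) := fun x =>
    ⟨c x, hc x, rfl⟩
  have hwU : ∀ x, w x ∈ unitaryGroup ι ℂ := fun x => by
    rw [Matrix.mem_unitaryGroup_iff', Matrix.star_eq_conjTranspose]
    have := (hwp x).conj_eq 1
    rwa [mul_one, mul_one, rep_conjTranspose_mul_self] at this
  have hplus : PhaseEq ((S.spinRot p fun _ : X => t)ᴴ * S.spinRot p θ) (prodOp w) := by
    rw [spinRot, spinRot, prodOp_conjTranspose, prodOp_mul]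
    exact PhaseEq.prodOp fun x => (S.phaseEq_conjTranspose_mul p _ _).trans (hwp x).symm
  have hminus : PhaseEq ((S.spinRot p fun _ : X => -t)ᴴ * S.spinRot p (-θ)) (prodOp w)ᴴ := by
    rw [spinRot, spinRot, prodOp_conjTranspose, prodOp_conjTranspose, prodOp_mul]
    refine PhaseEq.prodOp fun x => (S.phaseEq_conjTranspose_mul p _ _).trans ?_
    rw [show (-θ) x - -t = -(θ x - t) by simp; ring]
    exact (S.phaseEq_rep_neg p _).trans (hwp x).symm.conjTranspose
  have e1 := hplus.conj_eq M
  have e2 := hminus.conj_eq M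
  rw [Matrix.conjTranspose_mul, Matrix.conjTranspose_conjTranspose] at e1 e2
  rw [Matrix.conjTranspose_conjTranspose] at e2
  have hs : ‖prodOp w - 1‖ ≤ C * ∑ x, |θ x - t| := by
    rw [Finset.mul_sum]
    exact (norm_prodOp_sub_one_le hwU).trans (Finset.sum_le_sum fun x _ => h x)
  have := norm_conj_add_conj_le (prodOp_mem_unitaryGroup hwU) M
  rw [← e1, ← e2] at this
  simp only [← mul_assoc] at this ⊢
  refine this.trans ?_
  gcongr

/-- The second order change of an operator under the rotations by the angles `±θ`. -/
def deformation {X : Type*} [Fintype X] [DecidableEq X] (θ : X → ℝ) : Op X ι →L[ℂ] Op X ι :=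
  (1 / 2 : ℂ) • (ContinuousLinearMap.mulLeftRight ℂ (Op X ι) (S.spinRot p θ)ᴴ (S.spinRot p θ) +
    ContinuousLinearMap.mulLeftRight ℂ (Op X ι) (S.spinRot p (-θ))ᴴ (S.spinRot p (-θ))) -
    ContinuousLinearMap.id ℂ (Op X ι)

lemma deformation_apply {X : Type*} [Fintype X] [DecidableEq X] (θ : X → ℝ) (M : Op X ι) :
    S.deformation p θ M = (1 / 2 : ℂ) • ((S.spinRot p θ)ᴴ * M * S.spinRot p θ +
      (S.spinRot p (-θ))ᴴ * M * S.spinRot p (-θ)) - M := rfl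

lemma spinRot_conj_embed {X Y : Type*} [Fintype X] [DecidableEq X] [Fintype Y] [DecidableEq Y]
    (θ : Y → ℝ) (f : X → Y) (M : Op X ι) :
    (S.spinRot p θ)ᴴ * embed f M * S.spinRot p θ =
      embed f ((S.spinRot p (θ ∘ f))ᴴ * M * S.spinRot p (θ ∘ f)) :=
  prodOp_conj_embed (fun _ => (S.rep _).2) M

variable {S} in
lemma norm_deformed_embed_sub_le {C : ℝ} (hC : S.PhaseLipschitz C) {X Y : Type*} [Fintype X]
    [DecidableEq X] [Fintype Y] [DecidableEq Y] (θ : Y → ℝ) (f : X → Y) (t : ℝ) (M : Op X ι) :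
    ‖(1 / 2 : ℂ) • ((S.spinRot p θ)ᴴ * embed f (S.spinRot p (fun _ => t) * M *
        (S.spinRot p fun _ => t)ᴴ) * S.spinRot p θ + (S.spinRot p (-θ))ᴴ *
        embed f (S.spinRot p (fun _ => -t) * M * (S.spinRot p fun _ => -t)ᴴ) *
        S.spinRot p (-θ)) - embed f M‖ ≤ 2 * (C * ∑ x, |θ (f x) - t|) ^ 2 * ‖M‖ := by
  rw [spinRot_conj_embed, spinRot_conj_embed]
  have : ∀ A B : Op X ι, (1 / 2 : ℂ) • (embed f A + embed f B) - embed f M =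
      embed f ((1 / 2 : ℂ) • (A + B) - M) := fun A B => by
    change (1 / 2 : ℂ) • (embedLin f A + embedLin f B) - embedLin f M = embedLin f _
    rw [map_sub, map_smul, map_add]
  rw [this]
  exact (norm_embed_le _ _).trans (norm_deformed_sub_le p hC (θ ∘ f) t M)

lemma conj_Q (t : ℝ) (A : Finset (Site d)) :
    S.spinRot p (fun _ : A => t) * S.Q A * (S.spinRot p fun _ : A => t)ᴴ = S.Q A := by
  have h := S.Q_rotate (p.rot t) A
  rw [← spinRot_const] at h
  have hU : S.spinRot p (fun _ : A => t) * (S.spinRot p fun _ : A => t)ᴴ = 1 :=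
    Unitary.mul_star_self_of_mem (S.spinRot_mem p _)
  conv_lhs => rw [← h]
  rw [← mul_assoc, ← mul_assoc, hU, one_mul, mul_assoc, hU, mul_one]

-- Since `Q_A` is invariant under rigid rotations, the reference angle `t` is free; it is chosen
-- later, depending on `A`.
variable {S} in
lemma norm_deformation_Q_le {C : ℝ} (hC : S.PhaseLipschitz C) {Y : Type*} [Fintype Y]
    [DecidableEq Y] (θ : Y → ℝ) (A : Finset (Site d)) (f : A → Y) (t : ℝ) :
    ‖S.deformation p θ (embed f (S.Q A))‖ ≤ 2 * (C * ∑ x, |θ (f x) - t|) ^ 2 * ‖S.Q A‖ := by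
  have := norm_deformed_embed_sub_le p hC θ f t (S.Q A)
  rwa [conj_Q, conj_Q] at this

end SymmetricSystem

end Deformation

/-! ### Distances, counting, and the angle profile on the periodic cube. -/

section TorusGeometry

namespace SymmetricSystem

variable {d K : ℕ}

/-- The supremum distance to the origin in the periodic cube. -/
def torusNorm (t : Torus d K) : ℕ := Finset.univ.sup fun i => (t i).valMinAbs.natAbs

lemma torusNorm_le_iff {t : Torus d K} {n : ℕ} :
    torusNorm t ≤ n ↔ ∀ i, (t i).valMinAbs.natAbs ≤ n := by
  simp [torusNorm]

/-- `valMinAbs` is the representative of least absolute value, so it can be compared with the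
representative obtained by adding `x i - y i` to that of `y i`. -/
lemma torusNorm_toTorus_le (x y : Site d) :
    (torusNorm (toTorus d K x) : ℝ) ≤ torusNorm (toTorus d K y) + dist x y := by
  have h : torusNorm (toTorus d K x) ≤ torusNorm (toTorus d K y) + ⌊dist x y⌋₊ := by
    rw [torusNorm_le_iff]
    intro i
    have h1 : (x i : ZMod (2 * K + 1)).valMinAbs.natAbs ≤
        ((y i : ZMod (2 * K + 1)).valMinAbs + (x i - y i)).natAbs := by
      apply ZMod.natAbs_min_of_le_div_two (2 * K + 1)
      · push_cast
        ring
      · exact ZMod.natAbs_valMinAbs_le _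
    refine h1.trans ((Int.natAbs_add_le _ _).trans (add_le_add ?_ ?_))
    · exact torusNorm_le_iff.1 (le_refl (torusNorm (toTorus d K y))) i
    · refine Nat.le_floor ?_
      have := dist_le_pi_dist x y i
      rwa [Int.dist_eq, ← Int.cast_sub, ← Int.cast_abs, Int.abs_eq_natAbs, Int.cast_natCast] at this
  calc (torusNorm (toTorus d K x) : ℝ) ≤ ((torusNorm (toTorus d K y) + ⌊dist x y⌋₊ : ℕ) : ℝ) := by
        exact_mod_cast h
    _ ≤ _ := by
        push_cast
        exact add_le_add le_rfl (Nat.floor_le dist_nonneg)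

lemma mem_box {n : ℕ} {x : Site d} : x ∈ box d n ↔ ∀ i, -(n : ℤ) ≤ x i ∧ x i ≤ n := by
  simp [box]

lemma torusNorm_toTorus_le_of_mem_box {n : ℕ} {x : Site d} (hx : x ∈ box d n) :
    torusNorm (toTorus d K x) ≤ n := by
  rw [torusNorm_le_iff]
  intro i
  have h1 : (x i : ZMod (2 * K + 1)).valMinAbs.natAbs ≤ (x i).natAbs := by
    apply ZMod.natAbs_min_of_le_div_two (2 * K + 1)
    · rw [ZMod.coe_valMinAbs]
    · exact ZMod.natAbs_valMinAbs_le _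
  have h2 := mem_box.1 hx i
  refine h1.trans ?_
  omega

lemma card_box (n : ℕ) : (box d n).card = (2 * n + 1) ^ d := by
  rw [box, Fintype.card_piFinset_const, Int.card_Icc]
  congr 1
  omega

/-- The sites of the periodic cube at distance less than `n` from the origin. -/
def torusBall (d K n : ℕ) : Finset (Torus d K) := Finset.univ.filter fun t => torusNorm t < n

lemma mem_torusBall {n : ℕ} {t : Torus d K} : t ∈ torusBall d K n ↔ torusNorm t < n := by
  simp [torusBall]

lemma card_torusBall_le (n : ℕ) : (torusBall d K n).card ≤ (2 * n + 1) ^ d := by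
  rw [← card_box]
  refine Finset.card_le_card_of_injOn (fun t i => (t i).valMinAbs) (fun t ht => ?_) ?_
  · rw [Finset.mem_coe, mem_torusBall] at ht
    rw [Finset.mem_coe, mem_box]
    intro i
    have := torusNorm_le_iff.1 ht.le i
    dsimp only
    omega
  · intro s _ t _ h
    ext1 i
    exact ZMod.injective_valMinAbs (congrFun h i)

lemma toTorus_injOn_box : Set.InjOn (toTorus d K) (box d K : Set (Site d)) := by
  intro x hx y hy h
  ext1 i
  have h1 := mem_box.1 hx i
  have h2 := mem_box.1 hy i
  have h3 := congrFun h i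
  simp only [toTorus] at h3
  rw [ZMod.intCast_eq_intCast_iff_dvd_sub] at h3
  obtain ⟨k, hk⟩ := h3
  push_cast at hk
  have : k = 0 := by
    rcases lt_trichotomy k 0 with hk0 | hk0 | hk0
    · nlinarith
    · exact hk0
    · nlinarith
  subst this
  omega

lemma toTorus_add (x y : Site d) : toTorus d K (x + y) = toTorus d K x + toTorus d K y := by
  ext1 i
  simp [toTorus]

/-- A translate of the cube `[-K, K]^d` is a fundamental domain, so each site of `T` is hit at most
once. -/
lemma card_filter_toTorus_le (T : Finset (Torus d K)) (a : Site d) :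
    ((box d K).filter fun x => toTorus d K (a + x) ∈ T).card ≤ T.card := by
  refine Finset.card_le_card_of_injOn (fun x => toTorus d K (a + x)) (fun x hx => ?_) ?_
  · exact (Finset.mem_filter.1 hx).2
  · intro x hx y hy h
    simp only [toTorus_add, add_right_inj] at h
    exact toTorus_injOn_box (Finset.mem_filter.1 hx).1 (Finset.mem_filter.1 hy).1 h

/-- An angle that increases from `0` on the cube of radius `m` to `π` off the cube of radius
`m + L`. -/
def profile (m L : ℕ) (t : Torus d K) : ℝ :=
  Real.pi * min 1 (max 0 (((torusNorm t : ℝ) - m) / L))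

lemma profile_eq_zero {m L : ℕ} {t : Torus d K} (h : torusNorm t ≤ m) : profile m L t = 0 := by
  have : ((torusNorm t : ℝ) - m) / L ≤ 0 :=
    div_nonpos_of_nonpos_of_nonneg (sub_nonpos.2 (by exact_mod_cast h)) (Nat.cast_nonneg _)
  rw [profile, max_eq_left this, min_eq_right zero_le_one, mul_zero]

lemma profile_eq_pi {m L : ℕ} (hL : 1 ≤ L) {t : Torus d K} (h : m + L ≤ torusNorm t) :
    profile m L t = Real.pi := by
  have hL' : (0 : ℝ) < L := by exact_mod_cast hL
  have : 1 ≤ ((torusNorm t : ℝ) - m) / L := by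
    rw [le_div_iff₀ hL', one_mul, le_sub_iff_add_le, add_comm]
    exact_mod_cast h
  rw [profile, min_eq_left (this.trans (le_max_right _ _)), mul_one]

lemma abs_profile_sub_le {m L : ℕ} (hL : 1 ≤ L) (x y : Site d) :
    |profile m L (toTorus d K x) - profile m L (toTorus d K y)| ≤ Real.pi / L * dist x y := by
  have hL' : (0 : ℝ) < L := by exact_mod_cast hL
  have h1 : |(torusNorm (toTorus d K x) : ℝ) - torusNorm (toTorus d K y)| ≤ dist x y := by
    have h2 := torusNorm_toTorus_le (K := K) x y
    have h3 := torusNorm_toTorus_le (K := K) y x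
    rw [dist_comm] at h3
    rw [abs_le]
    constructor <;> linarith
  rw [profile, profile, ← mul_sub, abs_mul, abs_of_pos Real.pi_pos, div_mul_eq_mul_div,
    mul_div_assoc]
  refine mul_le_mul_of_nonneg_left ?_ Real.pi_pos.le
  have h4 : ∀ a b : ℝ, |min 1 (max 0 a) - min 1 (max 0 b)| ≤ |a - b| := fun a b => by
    refine (abs_min_sub_min_le_max _ _ _ _).trans ?_
    rw [sub_self, abs_zero, max_eq_right (abs_nonneg _)]
    refine (abs_max_sub_max_le_max _ _ _ _).trans ?_
    rw [sub_self, abs_zero, max_eq_right (abs_nonneg _)]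
  refine (h4 _ _).trans ?_
  rw [← sub_div, sub_sub_sub_cancel_right, abs_div, abs_of_pos hL']
  gcongr

end SymmetricSystem

end TorusGeometry

/-! ### The cost of a spin wave in the interaction energy. -/

section Interaction

set_option linter.unusedSectionVars false

open scoped Matrix.Norms.L2Operator

/-- No convergence of `f` is assumed: a non-summable family has `tsum` equal to `0`, for which the
bound is trivial. -/
lemma norm_map_tsum_le {α E F : Type*} [NormedAddCommGroup E] [NormedSpace ℂ E]
    [NormedAddCommGroup F] [NormedSpace ℂ F] [CompleteSpace F] (Φ : E →L[ℂ] F) {f : α → E}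
    {b : α → ℝ} (hb : Summable b) (h : ∀ a, ‖Φ (f a)‖ ≤ b a) : ‖Φ (∑' a, f a)‖ ≤ ∑' a, b a := by
  by_cases hf : Summable f
  · rw [Φ.map_tsum hf]
    exact tsum_of_norm_bounded hb.hasSum h
  · rw [tsum_eq_zero_of_not_summable hf, map_zero, norm_zero]
    exact tsum_nonneg fun a => (norm_nonneg _).trans (h a)

namespace SymmetricSystem

variable {d N : ℕ} {ι : Type*} [Fintype ι] [DecidableEq ι] (S : SymmetricSystem d N ι)

/-- Only finitely many sets of bounded diameter contain `0`. -/
lemma FiniteRange.shortRange {S : SymmetricSystem d N ι} (h : S.FiniteRange) : S.ShortRange := by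
  obtain ⟨r, hr⟩ := h
  have hfin : {A : {A : Finset (Site d) // (0 : Site d) ∈ A} |
      Metric.diam (A.1 : Set (Site d)) ≤ r}.Finite := by
    refine Set.Finite.of_finite_image (f := Subtype.val) ?_ Subtype.val_injective.injOn
    refine ((box d ⌊r⌋₊).powerset.finite_toSet).subset ?_
    rintro _ ⟨A, hA, rfl⟩
    rw [Finset.mem_coe, Finset.mem_powerset]
    intro x hx
    rw [mem_box]
    intro i
    have h1 : dist x 0 ≤ r :=
      (Metric.dist_le_diam_of_mem (Set.Finite.isBounded A.1.finite_toSet) hx A.2).trans hA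
    have h2 := (dist_le_pi_dist x 0 i).trans h1
    rw [Pi.zero_apply, Int.dist_eq, Int.cast_zero, sub_zero, ← Int.cast_abs, Int.abs_eq_natAbs,
      Int.cast_natCast] at h2
    have h3 := Nat.le_floor h2
    omega
  refine summable_of_ne_finset_zero (s := hfin.toFinset) fun A hA => ?_
  rw [Set.Finite.mem_toFinset, Set.mem_ofPred_eq, not_le] at hA
  rw [hr A.1 hA]
  simp [opNorm]

lemma diam_translate (x : Site d) (A : Finset (Site d)) :
    Metric.diam (translate x A : Set (Site d)) = Metric.diam (A : Set (Site d)) := by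
  rw [translate, Finset.coe_map]
  exact (IsometryEquiv.addRight x).isometry.diam_image _

lemma norm_Q_translate_le (x : Site d) (A : Finset (Site d)) : ‖S.Q (translate x A)‖ ≤ ‖S.Q A‖ := by
  set g : A → translate x A := fun a => ⟨a + x, add_mem_translate x a⟩ with hg
  have h : S.Q (translate x A) = embed g (S.Q A) := by
    have hinj : Function.Injective g := fun a b hab => by
      have := congrArg Subtype.val hab
      exact Subtype.ext (add_right_cancel this)
    have hsurj : ∀ y, y ∈ Set.range g := by
      rintro ⟨y, hy⟩
      obtain ⟨a, ha, rfl⟩ := Finset.mem_map.1 hy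
      exact ⟨⟨a, ha⟩, rfl⟩
    ext σ τ
    rw [S.Q_translate, embed, if_pos ⟨hinj, fun y hy => absurd (hsurj y) hy⟩]
    rfl
  rw [h]
  exact norm_embed_le g _

/-- The sets containing `0`, translated by `x`, are the sets containing `x`. -/
def translateEquiv (x : Site d) :
    {A : Finset (Site d) // (0 : Site d) ∈ A} ≃ {A : Finset (Site d) // x ∈ A} where
  toFun A := ⟨translate x A.1, Finset.mem_map.2 ⟨0, A.2, zero_add x⟩⟩
  invFun A := ⟨translate (-x) A.1, Finset.mem_map.2 ⟨x, A.2, add_neg_cancel x⟩⟩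
  left_inv A := by
    ext y
    simp [translate, Finset.mem_map]
  right_inv A := by
    ext y
    simp [translate, Finset.mem_map]

open Classical in
/-- Only the sites where the angle is not `π` matter for the deformation of an interaction term. -/
lemma norm_deformation_term_le (p : Plane N) {C : ℝ} (hC : S.PhaseLipschitz C) {K : ℕ}
    {θ : Torus d K → ℝ} {ℓ : ℝ} (hℓ : 0 ≤ ℓ)
    (hθ : ∀ x y : Site d, |θ (toTorus d K x) - θ (toTorus d K y)| ≤ ℓ * dist x y)
    {T : Finset (Torus d K)} (hT : ∀ t, t ∉ T → θ t = Real.pi) {A : Finset (Site d)}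
    (hA : A.Nonempty) :
    ‖S.deformation p θ (((A.card : ℂ))⁻¹ • embed (fun a : A => toTorus d K a) (S.Q A))‖ ≤
      2 * (C * ℓ) ^ 2 * (Metric.diam (A : Set (Site d)) ^ 2 *
        ((A.filter fun a => toTorus d K a ∈ T).card : ℝ) * ‖S.Q A‖) := by
  set D := Metric.diam (A : Set (Site d)) with hD
  set n := (A.filter fun a => toTorus d K a ∈ T).card with hn
  have hdist : ∀ a ∈ A, ∀ b ∈ A, dist a b ≤ D := fun a ha b hb =>
    Metric.dist_le_diam_of_mem (Set.Finite.isBounded A.finite_toSet) ha hb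
  have hD0 : 0 ≤ D := Metric.diam_nonneg
  have hnA : n ≤ A.card := Finset.card_filter_le _ _
  have hcard : (0 : ℝ) < A.card := by exact_mod_cast hA.card_pos
  -- If `A` has a site outside `T`, take `t = π`, so that all sites outside `T` drop out; otherwise
  -- take the angle at any site of `A`. In both cases at most `n` terms remain, each at most `ℓ *
  -- D`.
  obtain ⟨t, ht⟩ : ∃ t : ℝ, ∑ a : A, |θ (toTorus d K a) - t| ≤ n * (ℓ * D) := by
    have key : ∀ b ∈ A, (∀ a ∈ A, toTorus d K a ∉ T → θ (toTorus d K a) = θ (toTorus d K b)) →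
        ∑ a : A, |θ (toTorus d K a) - θ (toTorus d K b)| ≤ n * (ℓ * D) := by
      intro b hb hab
      rw [Finset.sum_coe_sort A fun a => |θ (toTorus d K a) - θ (toTorus d K b)|,
        ← Finset.sum_filter_of_ne (p := fun a => toTorus d K a ∈ T) (fun a ha h => by
          by_contra h'
          exact h (by rw [hab a ha h', sub_self, abs_zero])), hn, ← nsmul_eq_mul]
      refine Finset.sum_le_card_nsmul _ _ _ fun a ha => ?_
      exact (hθ a b).trans (mul_le_mul_of_nonneg_left (hdist a (Finset.mem_filter.1 ha).1 b hb) hℓ)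
    by_cases hex : ∃ b ∈ A, toTorus d K b ∉ T
    · obtain ⟨b, hb, hbT⟩ := hex
      exact ⟨_, key b hb fun a _ ha => by rw [hT _ ha, hT _ hbT]⟩
    · push Not at hex
      obtain ⟨b, hb⟩ := hA
      exact ⟨_, key b hb fun a ha haT => absurd (hex a ha) haT⟩
  have h1 := norm_deformation_Q_le p hC θ A (fun a => toTorus d K a) t
  have h2 : C * ∑ a : A, |θ (toTorus d K a) - t| ≤ C * ℓ * (n * D) := by
    calc C * ∑ a : A, |θ (toTorus d K a) - t| ≤ C * (n * (ℓ * D)) :=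
          mul_le_mul_of_nonneg_left ht hC.1
      _ = _ := by ring
  -- One of the two factors `n` is bounded by `A.card`, which cancels the weight in the interaction.
  -- The other is kept, to be summed over the translates of `A`.
  have h3 : (C * ∑ a : A, |θ (toTorus d K a) - t|) ^ 2 ≤ (C * ℓ) ^ 2 * (A.card * (n * D ^ 2)) := by
    calc (C * ∑ a : A, |θ (toTorus d K a) - t|) ^ 2 ≤ (C * ℓ * (n * D)) ^ 2 :=
          pow_le_pow_left₀ (mul_nonneg hC.1 (Finset.sum_nonneg fun _ _ => abs_nonneg _)) h2 2
      _ = (C * ℓ) ^ 2 * (n * (n * D ^ 2)) := by ring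
      _ ≤ _ := by gcongr
  rw [map_smul, norm_smul, norm_inv, Complex.norm_natCast, inv_mul_le_iff₀ hcard]
  refine h1.trans ?_
  calc 2 * (C * ∑ a : A, |θ (toTorus d K a) - t|) ^ 2 * ‖S.Q A‖
      ≤ 2 * ((C * ℓ) ^ 2 * (A.card * (n * D ^ 2))) * ‖S.Q A‖ := by gcongr
    _ = _ := by ring

/-- The strength of the interaction. -/
def strength : ℝ := ∑' A : {A : Finset (Site d) // (0 : Site d) ∈ A},
    Metric.diam (A.1 : Set (Site d)) ^ 2 * (A.1.card : ℝ) * opNorm (S.Q A.1)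

lemma strength_nonneg : 0 ≤ S.strength :=
  tsum_nonneg fun _ => mul_nonneg (by positivity) (norm_nonneg _)

-- Translation invariance turns the sum over pairs `x ∈ A` into a sum over shapes `A ∋ 0` and
-- positions `x`. Summing over the positions first, each shape costs at most `A.card * T.card`,
-- which leaves the series of the short range condition.
open Classical in
lemma norm_deformation_interaction_le (hS : S.ShortRange) (p : Plane N) {C : ℝ}
    (hC : S.PhaseLipschitz C) {K : ℕ} {θ : Torus d K → ℝ} {ℓ : ℝ} (hℓ : 0 ≤ ℓ)
    (hθ : ∀ x y : Site d, |θ (toTorus d K x) - θ (toTorus d K y)| ≤ ℓ * dist x y)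
    {T : Finset (Torus d K)} (hT : ∀ t, t ∉ T → θ t = Real.pi) :
    ‖S.deformation p θ (S.interaction K)‖ ≤ 2 * (C * ℓ) ^ 2 * (T.card * S.strength) := by
  set n : Site d → {A : Finset (Site d) // (0 : Site d) ∈ A} → ℕ := fun x A =>
    (A.1.filter fun a => toTorus d K (a + x) ∈ T).card with hn
  set c : {A : Finset (Site d) // (0 : Site d) ∈ A} → ℝ := fun A =>
    2 * (C * ℓ) ^ 2 * (Metric.diam (A.1 : Set (Site d)) ^ 2 * ‖S.Q A.1‖) with hc
  have hc0 : ∀ A, 0 ≤ c A := fun A => by positivity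
  have hsum : Summable fun A => c A * A.1.card := by
    refine (Summable.mul_left (2 * (C * ℓ) ^ 2) hS).congr fun A => ?_
    rw [hc]
    simp only [opNorm, cstar_norm_def]
    ring
  have hsum' : ∀ x, Summable fun A => c A * n x A := fun x =>
    hsum.of_nonneg_of_le (fun A => mul_nonneg (hc0 A) (Nat.cast_nonneg _)) fun A =>
      mul_le_mul_of_nonneg_left (by exact_mod_cast Finset.card_filter_le _ _) (hc0 A)
  have hx : ∀ x : Site d, ‖S.deformation p θ (∑' A : {A : Finset (Site d) // x ∈ A},
      ((A.1.card : ℂ))⁻¹ • embed (fun a : A.1 => toTorus d K a) (S.Q A.1))‖ ≤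
        ∑' A, c A * n x A := by
    intro x
    rw [← (translateEquiv x).tsum_eq]
    refine norm_map_tsum_le _ (hsum' x) fun A => ?_
    refine (S.norm_deformation_term_le p hC hℓ hθ hT ⟨x, (translateEquiv x A).2⟩).trans ?_
    have e1 : (translateEquiv x A).1 = translate x A.1 := rfl
    have e2 : ((translate x A.1).filter fun a => toTorus d K a ∈ T).card = n x A := by
      rw [translate, Finset.filter_map, Finset.card_map]
      rfl
    rw [e1, diam_translate, e2, hc]
    have e3 := S.norm_Q_translate_le x A.1
    calc _ ≤ 2 * (C * ℓ) ^ 2 * (Metric.diam (A.1 : Set (Site d)) ^ 2 * (n x A) * ‖S.Q A.1‖) := by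
          gcongr
      _ = _ := by ring
  rw [interaction, map_sum]
  refine (norm_sum_le _ _).trans ((Finset.sum_le_sum fun x _ => hx x).trans ?_)
  rw [← Summable.tsum_finsetSum fun x _ => hsum' x]
  -- Double counting: for each fixed `a ∈ A`, at most `T.card` positions `x` bring `a + x` into `T`.
  have hcount : ∀ A, ∑ x ∈ box d K, n x A ≤ A.1.card * T.card := by
    intro A
    simp only [hn, Finset.card_filter]
    rw [Finset.sum_comm]
    refine (Finset.sum_le_card_nsmul _ _ T.card fun a _ => ?_).trans_eq (smul_eq_mul _ _)
    rw [← Finset.card_filter]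
    convert card_filter_toTorus_le T a
  calc ∑' A, ∑ x ∈ box d K, c A * n x A ≤ ∑' A, c A * A.1.card * T.card := by
        refine Summable.tsum_le_tsum (fun A => ?_) (summable_sum fun x _ => hsum' x)
          (hsum.mul_right _)
        refine (Finset.mul_sum (box d K) (fun x => (n x A : ℝ)) (c A)).symm.trans_le ?_
        rw [mul_assoc (c A)]
        refine mul_le_mul_of_nonneg_left ?_ (hc0 A)
        exact_mod_cast hcount A
    _ = _ := by
        rw [tsum_mul_right, strength, mul_comm (T.card : ℝ), ← mul_assoc, ← tsum_mul_left]
        congr 1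
        refine tsum_congr fun A => ?_
        rw [hc]
        simp only [opNorm, cstar_norm_def]
        ring

end SymmetricSystem

end Interaction

/-! ### Field terms, and the comparison of opposite uniform fields. -/

section Fields

set_option linter.unusedSectionVars false

open scoped Matrix.Norms.L2Operator

lemma rotate_add {N : ℕ} (R : Matrix.specialOrthogonalGroup (Fin N) ℝ) (v w : Vec N) :
    rotate R (v + w) = rotate R v + rotate R w := by
  ext k; simp [rotate, Matrix.mulVec_add]

lemma rotate_smul {N : ℕ} (R : Matrix.specialOrthogonalGroup (Fin N) ℝ) (c : ℝ) (v : Vec N) :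
    rotate R (c • v) = c • rotate R v := by
  ext k; simp [rotate, Matrix.mulVec_smul]

lemma rotate_one {N : ℕ} (v : Vec N) : rotate 1 v = v := by
  ext k; simp [rotate]

lemma rotate_zero {N : ℕ} (R : Matrix.specialOrthogonalGroup (Fin N) ℝ) :
    rotate R (0 : Vec N) = 0 := by
  ext k; simp [rotate]

lemma continuous_rotate {N : ℕ} (R : Matrix.specialOrthogonalGroup (Fin N) ℝ) :
    Continuous (rotate R) := by
  unfold rotate
  fun_prop

lemma Plane.norm_rotate_le {N : ℕ} (p : Plane N) (t : ℝ) (v : Vec N) :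
    ‖rotate (p.rot t) v‖ ≤ ‖v‖ := by
  have h1 : ‖p.rotMatrix t‖ ≤ 1 := by
    have h := l2_opNorm_conjTranspose_mul_self (p.rotMatrix t)
    rw [Matrix.conjTranspose_eq_transpose_of_trivial, p.rotMatrix_transpose, ← p.rotMatrix_add,
      neg_add_cancel, p.rotMatrix_zero] at h
    have h2 : ‖(1 : Matrix (Fin N) (Fin N) ℝ)‖ ≤ 1 := by
      have h3 := l2_opNorm_conjTranspose_mul_self (1 : Matrix (Fin N) (Fin N) ℝ)
      rw [Matrix.conjTranspose_one, one_mul] at h3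
      by_contra! H
      nlinarith
    by_contra! H
    nlinarith
  calc ‖rotate (p.rot t) v‖ ≤ ‖p.rotMatrix t‖ * ‖v‖ := l2_opNorm_mulVec (p.rotMatrix t) v
    _ ≤ _ := mul_le_of_le_one_left (norm_nonneg _) h1

namespace SymmetricSystem

variable {d N : ℕ} {ι : Type*} [Fintype ι] [DecidableEq ι] (S : SymmetricSystem d N ι)

/-- The component of the vector operator in a direction. -/
def fieldOp (v : Vec N) : Op S.cluster ι := ∑ k, (v k : ℂ) • S.lop k

lemma fieldOp_sub (v w : Vec N) : S.fieldOp (v - w) = S.fieldOp v - S.fieldOp w := by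
  simp only [fieldOp, ← Finset.sum_sub_distrib, ← sub_smul]
  simp

lemma fieldOp_isHermitian (v : Vec N) : (S.fieldOp v).IsHermitian := by
  rw [Matrix.IsHermitian, fieldOp, Matrix.conjTranspose_sum]
  refine Finset.sum_congr rfl fun k _ => ?_
  rw [Matrix.conjTranspose_smul, (S.lop_hermitian k).eq]
  simp

/-- A bound for the vector operator. -/
def lopBound : ℝ := ∑ k, ‖S.lop k‖

lemma lopBound_nonneg : 0 ≤ S.lopBound := Finset.sum_nonneg fun _ _ => norm_nonneg _

lemma norm_fieldOp_le (v : Vec N) : ‖S.fieldOp v‖ ≤ S.lopBound * ‖v‖ := by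
  rw [fieldOp, lopBound, Finset.sum_mul]
  refine (norm_sum_le _ _).trans (Finset.sum_le_sum fun k _ => ?_)
  rw [norm_smul, Complex.norm_real, mul_comm]
  exact mul_le_mul_of_nonneg_left (PiLp.norm_apply_le v k) (norm_nonneg _)

lemma fieldOp_rotate (p : Plane N) (t : ℝ) (v : Vec N) :
    S.fieldOp (rotate (p.rot t) v) = S.spinRot p (fun _ => t) * S.fieldOp v *
      (S.spinRot p fun _ => t)ᴴ := (S.lop_rotate (p.rot t) v).symm

/-- The Hamiltonian with the field `v x` at the site `x`. -/
def energy (K : ℕ) (v : Site d → Vec N) : Op (Torus d K) ι :=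
  S.interaction K +
    ∑ x ∈ box d K, embed (fun a : S.cluster => toTorus d K (a + x)) (S.fieldOp (v x))

lemma hamiltonian_eq_energy (ε : ℝ) (K : ℕ) (h : Vec N) (η : Site d → Vec N) :
    S.hamiltonian ε K h η = S.energy K fun x => h + ε • η x := by
  rw [hamiltonian, energy]
  congr 1
  refine Finset.sum_congr rfl fun x _ => ?_
  change _ = embedLin _ (S.fieldOp _)
  rw [fieldOp, map_sum]
  refine Finset.sum_congr rfl fun k _ => ?_
  rw [map_smul]
  rfl

lemma interaction_isHermitian (K : ℕ) : (S.interaction K).IsHermitian := by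
  rw [Matrix.IsHermitian, interaction, Matrix.conjTranspose_sum]
  refine Finset.sum_congr rfl fun x _ => ?_
  rw [Matrix.conjTranspose_tsum]
  refine tsum_congr fun A => ?_
  rw [Matrix.conjTranspose_smul, (embed_isHermitian _ (S.Q_hermitian _)).eq]
  simp

lemma energy_isHermitian (K : ℕ) (v : Site d → Vec N) : (S.energy K v).IsHermitian := by
  refine (S.interaction_isHermitian K).add ?_
  rw [Matrix.IsHermitian, Matrix.conjTranspose_sum]
  exact Finset.sum_congr rfl fun x _ => embed_isHermitian _ (S.fieldOp_isHermitian _)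

lemma norm_energy_sub_le (K : ℕ) (v w : Site d → Vec N) :
    ‖S.energy K v - S.energy K w‖ ≤ S.lopBound * ∑ x ∈ box d K, ‖v x - w x‖ := by
  rw [energy, energy, add_sub_add_left_eq_sub, ← Finset.sum_sub_distrib, Finset.mul_sum]
  refine (norm_sum_le _ _).trans (Finset.sum_le_sum fun x _ => ?_)
  have : embed (fun a : S.cluster => toTorus d K (a + x)) (S.fieldOp (v x)) -
      embed (fun a : S.cluster => toTorus d K (a + x)) (S.fieldOp (w x)) =
      embed (fun a : S.cluster => toTorus d K (a + x)) (S.fieldOp (v x - w x)) := by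
    rw [fieldOp_sub]
    exact (map_sub (embedLin _) _ _).symm
  rw [this]
  exact (norm_embed_le _ _).trans (S.norm_fieldOp_le _)

lemma abs_freeEnergy_energy_sub_le [Nonempty ι] {β : ENNReal} (hβ : β ≠ 0) (K : ℕ)
    (v w : Site d → Vec N) : |freeEnergy β (S.energy K v) - freeEnergy β (S.energy K w)| ≤
      S.lopBound * ∑ x ∈ box d K, ‖v x - w x‖ :=
  (abs_freeEnergy_sub_le hβ (S.energy_isHermitian K v) (S.energy_isHermitian K w)).trans
    (S.norm_energy_sub_le K v w)

/-- The extent of the vector operator. -/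
def clusterSize : ℝ := ∑ a : S.cluster, dist (a : Site d) 0

lemma dist_le_clusterSize {a : Site d} (ha : a ∈ S.cluster) : dist a 0 ≤ S.clusterSize := by
  rw [clusterSize, Finset.sum_coe_sort S.cluster fun a => dist a 0]
  exact Finset.single_le_sum (f := fun a => dist a 0) (fun _ _ => dist_nonneg) ha

/-- Rotating the field vector at `x` is a rigid rotation of its cluster by `θ x`, because the
operators form a vector. What remains is the variation of `θ` over the cluster, which vanishes
unless `x ∈ B`. -/
lemma norm_deformed_field_sub_le (p : Plane N) {C : ℝ} (hC : S.PhaseLipschitz C) {K : ℕ}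
    {θ : Torus d K → ℝ} {ℓ : ℝ}
    (hθ : ∀ x y : Site d, |θ (toTorus d K x) - θ (toTorus d K y)| ≤ ℓ * dist x y)
    {B : Finset (Site d)} (hB : ∀ x ∈ box d K, x ∉ B → ∀ a ∈ S.cluster,
      θ (toTorus d K (a + x)) = θ (toTorus d K x)) {x : Site d} (hx : x ∈ box d K) (v : Vec N) :
    ‖(1 / 2 : ℂ) • ((S.spinRot p θ)ᴴ * embed (fun a : S.cluster => toTorus d K (a + x))
        (S.fieldOp (rotate (p.rot (θ (toTorus d K x))) v)) * S.spinRot p θ +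
        (S.spinRot p (-θ))ᴴ * embed (fun a : S.cluster => toTorus d K (a + x))
        (S.fieldOp (rotate (p.rot (-θ (toTorus d K x))) v)) * S.spinRot p (-θ)) -
        embed (fun a : S.cluster => toTorus d K (a + x)) (S.fieldOp v)‖ ≤
      if x ∈ B then 2 * (C * ℓ * S.clusterSize) ^ 2 * (S.lopBound * ‖v‖) else 0 := by
  rw [fieldOp_rotate, fieldOp_rotate]
  refine (norm_deformed_embed_sub_le p hC θ _ (θ (toTorus d K x)) (S.fieldOp v)).trans ?_
  split_ifs with hxB
  · have h1 : C * ∑ a : S.cluster, |θ (toTorus d K (a + x)) - θ (toTorus d K x)| ≤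
        C * ℓ * S.clusterSize := by
      rw [mul_assoc, clusterSize, Finset.mul_sum Finset.univ _ ℓ]
      refine mul_le_mul_of_nonneg_left (Finset.sum_le_sum fun a _ => ?_) hC.1
      refine (hθ _ _).trans (le_of_eq ?_)
      congr 1
      rw [dist_eq_norm, dist_eq_norm, add_sub_cancel_right, sub_zero]
    refine mul_le_mul (mul_le_mul_of_nonneg_left (pow_le_pow_left₀ ?_ h1 2) zero_le_two)
      (S.norm_fieldOp_le v) (norm_nonneg _) (by positivity)
    exact mul_nonneg hC.1 (Finset.sum_nonneg fun _ _ => abs_nonneg _)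
  · have : ∑ a : S.cluster, |θ (toTorus d K (a + x)) - θ (toTorus d K x)| = 0 :=
      Finset.sum_eq_zero fun a _ => by rw [hB x hx hxB a a.2, sub_self, abs_zero]
    rw [this]
    simp

-- After conjugation by the spin waves, which preserves the free energies, the two Hamiltonians with
-- rotated fields have a mean close to the original one, and the midpoint inequality applies. The
-- error splits into an interaction part and a field part.
open Classical in
lemma freeEnergy_rotated_le [Nonempty ι] (hS : S.ShortRange) {β : ENNReal} (hβ : β ≠ 0)
    (p : Plane N) {C : ℝ} (hC : S.PhaseLipschitz C) {K : ℕ}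
    {θ : Torus d K → ℝ} {ℓ : ℝ} (hℓ : 0 ≤ ℓ)
    (hθ : ∀ x y : Site d, |θ (toTorus d K x) - θ (toTorus d K y)| ≤ ℓ * dist x y)
    {T : Finset (Torus d K)} (hT : ∀ t, t ∉ T → θ t = Real.pi)
    {B : Finset (Site d)} (hBK : B ⊆ box d K) (hB : ∀ x ∈ box d K, x ∉ B → ∀ a ∈ S.cluster,
      θ (toTorus d K (a + x)) = θ (toTorus d K x)) (v : Site d → Vec N) :
    (freeEnergy β (S.energy K fun x => rotate (p.rot (θ (toTorus d K x))) (v x)) +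
      freeEnergy β (S.energy K fun x => rotate (p.rot (-θ (toTorus d K x))) (v x))) / 2 ≤
      freeEnergy β (S.energy K v) + (2 * (C * ℓ) ^ 2 * (T.card * S.strength) +
        2 * (C * ℓ * S.clusterSize) ^ 2 * (S.lopBound * ∑ x ∈ B, ‖v x‖)) := by
  have hU := S.spinRot_mem p θ
  have hU' := S.spinRot_mem p (-θ)
  rw [← freeEnergy_conj hU β (S.energy K _), ← freeEnergy_conj hU' β
    (S.energy K fun x => rotate (p.rot (-θ (toTorus d K x))) (v x))]
  refine freeEnergy_midpoint_le hβ (isHermitian_conjTranspose_mul_mul _ (S.energy_isHermitian K _))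
    (isHermitian_conjTranspose_mul_mul _ (S.energy_isHermitian K _)) (S.energy_isHermitian K _) ?_
  have e : (1 / 2 : ℂ) • ((S.spinRot p θ)ᴴ *
      (S.energy K fun x => rotate (p.rot (θ (toTorus d K x))) (v x)) * S.spinRot p θ +
      (S.spinRot p (-θ))ᴴ * (S.energy K fun x => rotate (p.rot (-θ (toTorus d K x))) (v x)) *
      S.spinRot p (-θ)) - S.energy K v = S.deformation p θ (S.interaction K) +
      ∑ x ∈ box d K, ((1 / 2 : ℂ) • ((S.spinRot p θ)ᴴ *
        embed (fun a : S.cluster => toTorus d K (a + x))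
        (S.fieldOp (rotate (p.rot (θ (toTorus d K x))) (v x))) * S.spinRot p θ +
        (S.spinRot p (-θ))ᴴ * embed (fun a : S.cluster => toTorus d K (a + x))
        (S.fieldOp (rotate (p.rot (-θ (toTorus d K x))) (v x))) * S.spinRot p (-θ)) -
        embed (fun a : S.cluster => toTorus d K (a + x)) (S.fieldOp (v x))) := by
    rw [deformation_apply, energy, energy, energy, Finset.sum_sub_distrib, ← Finset.smul_sum,
      Finset.sum_add_distrib, ← Finset.sum_mul, ← Finset.sum_mul, ← Finset.mul_sum,
      ← Finset.mul_sum]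
    simp only [mul_add, add_mul, smul_add]
    abel
  rw [e]
  refine (norm_add_le _ _).trans (add_le_add
    (S.norm_deformation_interaction_le hS p hC hℓ hθ hT) ?_)
  refine (norm_sum_le _ _).trans ((Finset.sum_le_sum fun x hx =>
    S.norm_deformed_field_sub_le p hC hθ hB hx (v x)).trans ?_)
  rw [← Finset.sum_filter, Finset.filter_mem_eq_inter, Finset.inter_eq_right.2 hBK,
    ← Finset.mul_sum, ← Finset.mul_sum]

/-- The constant comes from `2 * n + 1 ≤ 4 * L + 4 * r + 1 ≤ (5 + 4 * r) * L`. -/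
lemma card_torusBall_le_mul {d K r L n : ℕ} (hL : 1 ≤ L) (hn : n ≤ 2 * L + 2 * r) :
    ((torusBall d K n).card : ℝ) ≤ (5 + 4 * r) ^ d * L ^ d := by
  have hL' : (1 : ℝ) ≤ L := by exact_mod_cast hL
  have hn' : (n : ℝ) ≤ 2 * L + 2 * r := by exact_mod_cast hn
  have hrL : (r : ℝ) ≤ r * L := le_mul_of_one_le_right (Nat.cast_nonneg _) hL'
  calc ((torusBall d K n).card : ℝ) ≤ ((2 * n + 1) ^ d : ℕ) := by
        exact_mod_cast card_torusBall_le n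
    _ = (2 * (n : ℝ) + 1) ^ d := by push_cast; rfl
    _ ≤ ((5 + 4 * r) * L) ^ d := pow_le_pow_left₀ (by positivity) (by nlinarith) d
    _ = _ := by rw [mul_pow]

open Classical in
/-- The angles of the rotations of the spins: `0` near the cube `[-L, L]^d`, `π` far from it, and
slowly varying. -/
lemma exists_angle (d r : ℕ) {L : ℕ} (hL : 1 ≤ L) (K : ℕ) :
    ∃ (θ : Torus d K → ℝ) (T : Finset (Torus d K)) (B : Finset (Site d)),
      (∀ x y : Site d, |θ (toTorus d K x) - θ (toTorus d K y)| ≤ Real.pi / L * dist x y) ∧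
      (∀ t, t ∉ T → θ t = Real.pi) ∧ (T.card : ℝ) ≤ (5 + 4 * r) ^ d * L ^ d ∧ B ⊆ box d K ∧
      (∀ x ∈ B, x ∉ box d L) ∧ (B.card : ℝ) ≤ (5 + 4 * r) ^ d * L ^ d ∧
      (∀ x ∈ box d L, θ (toTorus d K x) = 0) ∧
      ∀ x ∈ box d K, x ∉ B → ∀ a : Site d, dist a 0 ≤ r →
        θ (toTorus d K (a + x)) = θ (toTorus d K x) := by
  -- The inner radius `L + r` keeps the angle `0` on all clusters attached to `[-L, L]^d`. The angle
  -- is `π` from radius `2 * L + r` on, and from `2 * L + 2 * r` on this holds on whole clusters. So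
  -- `B` avoids `[-L, L]^d`, as the conditioning on the fields there will require.
  refine ⟨profile (L + r) L, torusBall d K (2 * L + r), (box d K).filter fun x =>
    toTorus d K x ∈ torusBall d K (2 * L + 2 * r) ∧ x ∉ box d L,
    fun x y => abs_profile_sub_le hL x y, fun t ht => ?_,
    card_torusBall_le_mul hL (by omega), Finset.filter_subset _ _,
    fun x hx => (Finset.mem_filter.1 hx).2.2, ?_, fun x hx => ?_, ?_⟩
  · rw [mem_torusBall, not_lt] at ht
    exact profile_eq_pi hL (by omega)
  · refine le_trans ?_ (card_torusBall_le_mul (K := K) hL le_rfl)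
    refine le_trans ?_ (Nat.cast_le.2 (card_filter_toTorus_le _ (0 : Site d)))
    refine Nat.cast_le.2 (Finset.card_le_card fun x hx => ?_)
    rw [Finset.mem_filter] at hx ⊢
    rw [zero_add]
    exact ⟨hx.1, hx.2.1⟩
  · exact profile_eq_zero ((torusNorm_toTorus_le_of_mem_box hx).trans (Nat.le_add_right _ _))
  · intro x hx hxB a ha
    have h1 : dist (a + x) x ≤ r := by
      rwa [dist_eq_norm, add_sub_cancel_right, ← sub_zero a, ← dist_eq_norm]
    have hle : torusNorm (toTorus d K (a + x)) ≤ torusNorm (toTorus d K x) + r := by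
      have := (torusNorm_toTorus_le (K := K) (a + x) x).trans (add_le_add le_rfl h1)
      exact_mod_cast this
    have hge : torusNorm (toTorus d K x) ≤ torusNorm (toTorus d K (a + x)) + r := by
      rw [dist_comm] at h1
      have := (torusNorm_toTorus_le (K := K) x (a + x)).trans (add_le_add le_rfl h1)
      exact_mod_cast this
    by_cases hxL : x ∈ box d L
    · have h2 := torusNorm_toTorus_le_of_mem_box (K := K) hxL
      have e1 : torusNorm (toTorus d K (a + x)) ≤ L + r := by omega
      have e2 : torusNorm (toTorus d K x) ≤ L + r := by omega
      rw [profile_eq_zero e1, profile_eq_zero e2]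
    · have h2 : toTorus d K x ∉ torusBall d K (2 * L + 2 * r) := fun h =>
        hxB (Finset.mem_filter.2 ⟨hx, h, hxL⟩)
      rw [mem_torusBall, not_lt] at h2
      have e1 : L + r + L ≤ torusNorm (toTorus d K (a + x)) := by omega
      have e2 : L + r + L ≤ torusNorm (toTorus d K x) := by omega
      rw [profile_eq_pi hL e1, profile_eq_pi hL e2]

open Classical in
/-- The rotation of the spins by an angle which is `0` near the cube `[-L, L]^d` and `π` far from
it changes the free energy only a little, on the average over the two directions of rotation. -/
lemma exists_rotation_bound [Nonempty ι] (hS : S.ShortRange) :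
    ∃ C : ℝ, 0 ≤ C ∧ ∀ (p : Plane N) (L : ℕ), 1 ≤ L → ∀ K : ℕ,
      ∃ (θ : Site d → ℝ) (B : Finset (Site d)), (∀ x ∈ box d L, θ x = 0) ∧
        (∀ x ∈ B, x ∉ box d L) ∧ (B.card : ℝ) ≤ C * L ^ d ∧
        (((box d K).filter fun x => θ x ≠ Real.pi).card : ℝ) ≤ C * L ^ d ∧
        ∀ (β : ENNReal), β ≠ 0 → ∀ v : Site d → Vec N,
          (freeEnergy β (S.energy K fun x => rotate (p.rot (θ x)) (v x)) +
            freeEnergy β (S.energy K fun x => rotate (p.rot (-θ x)) (v x))) / 2 ≤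
          freeEnergy β (S.energy K v) + C * (L ^ d / L ^ 2) + C / L ^ 2 * ∑ x ∈ B, ‖v x‖ := by
  obtain ⟨C₀, hC⟩ := S.exists_phase_lipschitz
  change S.PhaseLipschitz C₀ at hC
  obtain ⟨r, hr⟩ : ∃ r : ℕ, ∀ a ∈ S.cluster, dist a 0 ≤ (r : ℝ) :=
    ⟨⌈S.clusterSize⌉₊, fun a ha => (S.dist_le_clusterSize ha).trans (Nat.le_ceil _)⟩
  obtain ⟨c, hc⟩ : ∃ c : ℝ, c = (5 + 4 * r) ^ d := ⟨_, rfl⟩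
  obtain ⟨C₁, hC1⟩ : ∃ C₁ : ℝ, C₁ = 2 * (C₀ * Real.pi) ^ 2 * (c * S.strength) := ⟨_, rfl⟩
  obtain ⟨C₂, hC2⟩ : ∃ C₂ : ℝ, C₂ = 2 * (C₀ * Real.pi * S.clusterSize) ^ 2 * S.lopBound := ⟨_, rfl⟩
  have hc0 : 0 ≤ c := by rw [hc]; positivity
  have hC10 : 0 ≤ C₁ := by
    rw [hC1]; exact mul_nonneg (by positivity) (mul_nonneg hc0 S.strength_nonneg)
  have hC20 : 0 ≤ C₂ := by rw [hC2]; exact mul_nonneg (by positivity) S.lopBound_nonneg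
  refine ⟨c + C₁ + C₂, by positivity, fun p L hL K => ?_⟩
  have hL0 : (0 : ℝ) < L := by exact_mod_cast hL
  obtain ⟨θ, T, B, hlip, hT, hTc, hBK, hBL, hBc, h0, hB⟩ := exists_angle d r hL K
  rw [← hc] at hTc hBc
  have hcC : c * (L : ℝ) ^ d ≤ (c + C₁ + C₂) * L ^ d :=
    mul_le_mul_of_nonneg_right (by linarith) (by positivity)
  refine ⟨fun x => θ (toTorus d K x), B, h0, hBL, hBc.trans hcC, ?_, fun β hβ v => ?_⟩
  · refine le_trans ?_ (hTc.trans hcC)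
    refine le_trans ?_ (Nat.cast_le.2 (card_filter_toTorus_le T (0 : Site d)))
    refine Nat.cast_le.2 (Finset.card_le_card fun x hx => ?_)
    rw [Finset.mem_filter] at hx ⊢
    rw [zero_add]
    refine ⟨hx.1, ?_⟩
    by_contra h
    exact hx.2 (hT _ h)
  · refine (S.freeEnergy_rotated_le hS hβ p hC (ℓ := Real.pi / L) (by positivity) hlip hT hBK
      (fun x hx hxB a ha => hB x hx hxB a (hr a ha)) v).trans ?_
    rw [add_assoc]
    refine add_le_add le_rfl (add_le_add ?_ ?_)
    · calc 2 * (C₀ * (Real.pi / L)) ^ 2 * (T.card * S.strength)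
          ≤ 2 * (C₀ * (Real.pi / L)) ^ 2 * (c * L ^ d * S.strength) :=
            mul_le_mul_of_nonneg_left (mul_le_mul_of_nonneg_right hTc
              S.strength_nonneg) (by positivity)
        _ = C₁ * (L ^ d / L ^ 2) := by rw [hC1]; field_simp
        _ ≤ _ := mul_le_mul_of_nonneg_right (by linarith) (by positivity)
    · calc 2 * (C₀ * (Real.pi / L) * S.clusterSize) ^ 2 * (S.lopBound * ∑ x ∈ B, ‖v x‖)
          = C₂ / L ^ 2 * ∑ x ∈ B, ‖v x‖ := by rw [hC2]; field_simp
        _ ≤ _ := mul_le_mul_of_nonneg_right (div_le_div_of_nonneg_right (by linarith)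
              (by positivity)) (Finset.sum_nonneg fun _ _ => norm_nonneg _)

open Classical in
/-- The free energies in opposite uniform fields, with the random fields far from the cube
`[-L, L]^d` rotated. -/
lemma exists_flip_bound [Nonempty ι] (hS : S.ShortRange) (ε : ℝ) :
    ∃ C : ℝ, 0 ≤ C ∧ ∀ (e : Vec N) (p : Plane N), p.e = e.ofLp → ‖e‖ = 1 →
      ∀ (L : ℕ), 1 ≤ L → ∀ K : ℕ,
      ∃ (θ : Site d → ℝ) (B : Finset (Site d)), (∀ x ∈ box d L, θ x = 0) ∧
        (∀ x ∈ B, x ∉ box d L) ∧ (B.card : ℝ) ≤ C * L ^ d ∧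
        ∀ (β : ENNReal), β ≠ 0 → ∀ (δ : ℝ) (η : Site d → Vec N),
          (S.F β ε K (δ • e) (fun x => rotate (p.rot (θ x)) (η x)) +
            S.F β ε K (δ • e) (fun x => rotate (p.rot (-θ x)) (η x))) / 2 ≤
          S.F β ε K (-(δ • e)) η + C * (L ^ d / L ^ 2) + C * L ^ d * |δ| +
            C / L ^ 2 * ∑ x ∈ B, ‖η x‖ := by
  obtain ⟨C, hC, h⟩ := S.exists_rotation_bound hS
  set C' := C + C * |ε| + (C * C + 2 * S.lopBound * C) with hC'
  have hl := S.lopBound_nonneg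
  have hCC : C ≤ C' := by
    have : 0 ≤ C * |ε| + (C * C + 2 * S.lopBound * C) := by positivity
    linarith
  refine ⟨C', by positivity, fun e p hpe he L hL K => ?_⟩
  have hL' : (1 : ℝ) ≤ L := by exact_mod_cast hL
  have hL0 : (0 : ℝ) < L := by linarith
  obtain ⟨θ, B, h0, hB, hcard, hpi, hmain⟩ := h p L hL K
  refine ⟨θ, B, h0, hB, hcard.trans (mul_le_mul_of_nonneg_right hCC (by positivity)), ?_⟩
  intro β hβ δ η
  simp only [F, hamiltonian_eq_energy]
  -- For `τ = θ` and `τ = -θ`: the rotated field `-(δ • e)` is `δ • e` where `θ = π`, and replacing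
  -- it by `δ • e` at the other sites, at most `C * L ^ d` in number, changes each field by at most
  -- `2 * |δ|`.
  have key : ∀ τ : Site d → ℝ, (∀ x, θ x = Real.pi → rotate (p.rot (τ x)) e = -e) →
      freeEnergy β (S.energy K fun x => δ • e + ε • rotate (p.rot (τ x)) (η x)) ≤
      freeEnergy β (S.energy K fun x => rotate (p.rot (τ x)) (-(δ • e) + ε • η x)) +
        S.lopBound * (C * L ^ d * (2 * |δ|)) := by
    intro τ hτ
    have h1 := (le_abs_self _).trans (S.abs_freeEnergy_energy_sub_le hβ K
      (fun x => δ • e + ε • rotate (p.rot (τ x)) (η x))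
      (fun x => rotate (p.rot (τ x)) (-(δ • e) + ε • η x)))
    have h2 : ∑ x ∈ box d K, ‖δ • e + ε • rotate (p.rot (τ x)) (η x) -
        rotate (p.rot (τ x)) (-(δ • e) + ε • η x)‖ ≤ C * L ^ d * (2 * |δ|) := by
      have h3 : ∀ x, δ • e + ε • rotate (p.rot (τ x)) (η x) -
          rotate (p.rot (τ x)) (-(δ • e) + ε • η x) = δ • (e + rotate (p.rot (τ x)) e) := by
        intro x
        rw [rotate_add, ← neg_smul, rotate_smul, rotate_smul]
        module
      simp only [h3]
      rw [← Finset.sum_filter_of_ne (p := fun x => θ x ≠ Real.pi) (fun x _ hx hθ => by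
        rw [hτ x hθ, add_neg_cancel, smul_zero, norm_zero] at hx
        exact hx rfl)]
      refine (Finset.sum_le_card_nsmul _ _ (2 * |δ|) fun x _ => ?_).trans ?_
      · rw [norm_smul, Real.norm_eq_abs, mul_comm]
        refine mul_le_mul_of_nonneg_right ((norm_add_le _ _).trans ?_) (abs_nonneg _)
        have := p.norm_rotate_le (τ x) e
        linarith
      · rw [nsmul_eq_mul]
        exact mul_le_mul_of_nonneg_right hpi (by positivity)
    have h4 := mul_le_mul_of_nonneg_left h2 hl
    linarith
  have hrot : ∀ s : ℝ, p.rotMatrix s *ᵥ p.e = -p.e → rotate (p.rot s) e = -e := fun s hs => by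
    rw [hpe] at hs
    ext k
    exact congrFun hs k
  have k1 := key θ fun x hx => by rw [hx]; exact hrot _ p.rotMatrix_pi_mulVec
  have k2 := key (fun x => -θ x) fun x hx => by rw [hx]; exact hrot _ p.rotMatrix_neg_pi_mulVec
  have k3 := hmain β hβ fun x => -(δ • e) + ε • η x
  have k4 : ∑ x ∈ B, ‖-(δ • e) + ε • η x‖ ≤ C * L ^ d * |δ| + |ε| * ∑ x ∈ B, ‖η x‖ := by
    calc ∑ x ∈ B, ‖-(δ • e) + ε • η x‖ ≤ ∑ x ∈ B, (|δ| + |ε| * ‖η x‖) := by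
          refine Finset.sum_le_sum fun x _ => (norm_add_le _ _).trans (le_of_eq ?_)
          rw [norm_neg, norm_smul, norm_smul, he, mul_one, Real.norm_eq_abs, Real.norm_eq_abs]
      _ = B.card * |δ| + |ε| * ∑ x ∈ B, ‖η x‖ := by
          rw [Finset.sum_add_distrib, Finset.sum_const, nsmul_eq_mul, Finset.mul_sum]
      _ ≤ _ := by gcongr
  have k5 : C / L ^ 2 * ∑ x ∈ B, ‖-(δ • e) + ε • η x‖ ≤
      C * C * L ^ d * |δ| + C * |ε| / L ^ 2 * ∑ x ∈ B, ‖η x‖ := by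
    calc _ ≤ C / L ^ 2 * (C * L ^ d * |δ| + |ε| * ∑ x ∈ B, ‖η x‖) := by gcongr
      _ = (C * C * L ^ d * |δ|) / L ^ 2 + C * |ε| / L ^ 2 * ∑ x ∈ B, ‖η x‖ := by ring
      _ ≤ _ := by
          gcongr
          exact div_le_self (by positivity) (one_le_pow₀ hL')
  have hs : 0 ≤ ∑ x ∈ B, ‖η x‖ := Finset.sum_nonneg fun _ _ => norm_nonneg _
  have k6 : C * (L ^ d / L ^ 2 : ℝ) ≤ C' * (L ^ d / L ^ 2) :=
    mul_le_mul_of_nonneg_right hCC (by positivity)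
  have k7 : C * |ε| / L ^ 2 * ∑ x ∈ B, ‖η x‖ ≤ C' / L ^ 2 * ∑ x ∈ B, ‖η x‖ := by
    refine mul_le_mul_of_nonneg_right (div_le_div_of_nonneg_right ?_ (by positivity)) hs
    have : 0 ≤ C + (C * C + 2 * S.lopBound * C) := by positivity
    linarith
  have k8 : (C * C + 2 * S.lopBound * C) * (L ^ d * |δ|) ≤ C' * (L ^ d * |δ|) := by
    refine mul_le_mul_of_nonneg_right ?_ (by positivity)
    have : 0 ≤ C + C * |ε| := by positivity
    linarith
  have k9 : (C * C + 2 * S.lopBound * C) * (L ^ d * |δ|) =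
      C * C * L ^ d * |δ| + S.lopBound * (C * L ^ d * (2 * |δ|)) := by ring
  linarith

end SymmetricSystem

end Fields

/-! ### Conditional expectations and isotropy of the disorder. -/

section Disorder

set_option linter.unusedSectionVars false

/-- Conditioning removes the rotations, as `f₁` and `f₂` have the conditional expectation of `f₀`,
and replaces the possibly unbounded error terms `n x` by their mean `μ₁`. This is why the final
bound holds almost surely with a deterministic constant. -/
lemma condExp_le_of_average_le {Ω κ : Type*} {m mΩ : MeasurableSpace Ω} {P : Measure Ω}
    [IsProbabilityMeasure P] (hle : m ≤ mΩ) {f₀ f₁ f₂ g : Ω → ℝ} (hi₁ : Integrable f₁ P)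
    (hi₂ : Integrable f₂ P) (hig : Integrable g P) (hc₁ : P[f₁ | m] =ᵐ[P] P[f₀ | m])
    (hc₂ : P[f₂ | m] =ᵐ[P] P[f₀ | m]) {B : Finset κ} {n : κ → Ω → ℝ}
    (hn : ∀ x, Integrable (n x) P) {μ₁ : ℝ} (hcn : ∀ x ∈ B, P[n x | m] =ᵐ[P] fun _ => μ₁)
    {c a : ℝ} (h : ∀ ω, (f₁ ω + f₂ ω) / 2 ≤ g ω + c + a * ∑ x ∈ B, n x ω) :
    ∀ᵐ ω ∂P, (P[f₀ | m]) ω ≤ (P[g | m]) ω + c + a * (B.card * μ₁) := by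
  have hin : Integrable (∑ x ∈ B, n x) P := integrable_finsetSum' _ fun x _ => hn x
  have hpath : f₁ + f₂ ≤ᵐ[P] (2 : ℝ) • g + ((fun _ => 2 * c) + (2 * a) • ∑ x ∈ B, n x) := by
    refine ae_of_all _ fun ω => ?_
    have h1 := h ω
    simp only [Pi.add_apply, Pi.smul_apply, Finset.sum_apply, smul_eq_mul]
    linarith
  have hmono := condExp_mono (m := m) (hi₁.add hi₂)
    ((hig.smul (2 : ℝ)).add ((integrable_const _).add (hin.smul (2 * a)))) hpath
  have hsum : ∀ᵐ ω ∂P, ∀ x ∈ B, (P[n x | m]) ω = μ₁ := (Finset.eventually_all B).2 hcn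
  filter_upwards [hmono, hc₁, hc₂, condExp_add hi₁ hi₂ m,
    condExp_add (hig.smul (2 : ℝ)) ((integrable_const (2 * c)).add (hin.smul (2 * a))) m,
    condExp_smul (2 : ℝ) g m (μ := P),
    condExp_add (integrable_const (2 * c)) (hin.smul (2 * a)) m,
    condExp_smul (2 * a) (∑ x ∈ B, n x) m (μ := P),
    condExp_finsetSum (fun x (_ : x ∈ B) => hn x) m, hsum]
    with ω k1 k2 k3 k4 k5 k6 k7 k8 k9 k10
  rw [k4, k5, Pi.add_apply, Pi.add_apply, k2, k3, k6, k7, Pi.add_apply, k8, Pi.smul_apply,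
    Pi.smul_apply, k9, Finset.sum_apply, Finset.sum_congr rfl k10, condExp_const hle,
    Finset.sum_const, nsmul_eq_mul, smul_eq_mul, smul_eq_mul] at k1
  linarith

variable {d N : ℕ} {Ω : Type*} [mΩ : MeasurableSpace Ω] {P : Measure Ω} [IsProbabilityMeasure P]
  {η : Site d → Ω → Vec N}

namespace IsotropicDisorder

lemma integrable_norm (hη : IsotropicDisorder P η) (x : Site d) :
    Integrable (fun ω => ‖η x ω‖) P :=
  ((hη.finite_variance x).integrable (by norm_num)).norm

lemma integral_norm_eq (hη : IsotropicDisorder P η) (x : Site d) :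
    ∫ ω, ‖η x ω‖ ∂P = ∫ ω, ‖η 0 ω‖ ∂P :=
  ((hη.ident x 0).comp measurable_norm).integral_eq

lemma measurable_field (hη : IsotropicDisorder P η) : Measurable fun ω x => η x ω :=
  measurable_pi_iff.2 hη.measurable

lemma measurable_rotated (hη : IsotropicDisorder P η)
    (R : Site d → Matrix.specialOrthogonalGroup (Fin N) ℝ) :
    Measurable fun ω x => rotate (R x) (η x ω) :=
  measurable_pi_iff.2 fun x => (continuous_rotate (R x)).measurable.comp (hη.measurable x)

/-- Rotating the random vectors independently of each other does not change their joint law. -/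
lemma map_rotated (hη : IsotropicDisorder P η)
    (R : Site d → Matrix.specialOrthogonalGroup (Fin N) ℝ) :
    P.map (fun ω x => rotate (R x) (η x ω)) = P.map fun ω x => η x ω := by
  have hm : ∀ x, Measurable fun ω => rotate (R x) (η x ω) := fun x =>
    (continuous_rotate (R x)).measurable.comp (hη.measurable x)
  have h1 : iIndepFun (fun x ω => rotate (R x) (η x ω)) P :=
    hη.indep.comp (fun x => rotate (R x)) fun x => (continuous_rotate (R x)).measurable
  rw [(iIndepFun_iff_map_fun_eq_infinitePi_map hm).1 h1,
    (iIndepFun_iff_map_fun_eq_infinitePi_map hη.measurable).1 hη.indep]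
  congr 1
  ext1 x
  exact hη.rotation_invariant (R x) x

lemma integrable_comp_rotated (hη : IsotropicDisorder P η)
    (R : Site d → Matrix.specialOrthogonalGroup (Fin N) ℝ) {Φ : (Site d → Vec N) → ℝ}
    (hΦ : Measurable Φ) (hi : Integrable (fun ω => Φ fun x => η x ω) P) :
    Integrable (fun ω => Φ fun x => rotate (R x) (η x ω)) P := by
  have h1 : Integrable Φ (P.map fun ω x => η x ω) :=
    (integrable_map_measure hΦ.aestronglyMeasurable hη.measurable_field.aemeasurable).2 hi
  rw [← hη.map_rotated R] at h1
  exact (integrable_map_measure hΦ.aestronglyMeasurable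
    (hη.measurable_rotated R).aemeasurable).1 h1

end IsotropicDisorder

/-- The information on the components of the fields in `[-L, L]^d` in the direction `e`. -/
abbrev componentAlgebra (η : Site d → Ω → Vec N) (e : Vec N) (L : ℕ) : MeasurableSpace Ω :=
  MeasurableSpace.comap (fun ω (x : box d L) => (inner ℝ e (η x ω) : ℝ)) inferInstance

lemma measurable_components (e : Vec N) (L : ℕ) :
    Measurable fun (v : Site d → Vec N) (x : box d L) => (inner ℝ e (v x) : ℝ) :=
  measurable_pi_iff.2 fun x =>
    (continuous_const.inner continuous_id).measurable.comp (measurable_pi_apply (x : Site d))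

namespace IsotropicDisorder

lemma componentAlgebra_le (hη : IsotropicDisorder P η) (e : Vec N) (L : ℕ) :
    componentAlgebra η e L ≤ mΩ :=
  ((measurable_components e L).comp hη.measurable_field).comap_le

/-- Rotating the random vectors off `[-L, L]^d` does not change conditional expectations. -/
lemma condExp_rotated (hη : IsotropicDisorder P η) (e : Vec N) (L : ℕ)
    {R : Site d → Matrix.specialOrthogonalGroup (Fin N) ℝ} (hR : ∀ x ∈ box d L, R x = 1)
    {Φ : (Site d → Vec N) → ℝ} (hΦ : Measurable Φ)
    (hi : Integrable (fun ω => Φ fun x => η x ω) P) :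
    P[fun ω => Φ fun x => rotate (R x) (η x ω) | componentAlgebra η e L] =ᵐ[P]
      P[fun ω => Φ fun x => η x ω | componentAlgebra η e L] := by
  have hle := hη.componentAlgebra_le e L
  refine (ae_eq_condExp_of_forall_setIntegral_eq hle (hη.integrable_comp_rotated R hΦ hi)
    (fun s _ _ => integrable_condExp.integrableOn) (fun s hs _ => ?_)
    stronglyMeasurable_condExp.aestronglyMeasurable).symm
  rw [setIntegral_condExp hle hi hs]
  obtain ⟨B, hB, rfl⟩ := hs
  set B' := (fun (v : Site d → Vec N) (x : box d L) => (inner ℝ e (v x) : ℝ)) ⁻¹' B with hB'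
  have hBm : MeasurableSet B' := measurable_components e L hB
  have e1 := setIntegral_map (μ := P) hBm hΦ.aestronglyMeasurable
    hη.measurable_field.aemeasurable
  have e2 := setIntegral_map (μ := P) hBm hΦ.aestronglyMeasurable
    (hη.measurable_rotated R).aemeasurable
  rw [hη.map_rotated R, e1] at e2
  have hs : (fun ω x => rotate (R x) (η x ω)) ⁻¹' B' =
      (fun ω (x : box d L) => (inner ℝ e (η x ω) : ℝ)) ⁻¹' B := by
    rw [hB', ← Set.preimage_comp]
    congr 1
    ext ω x
    simp only [Function.comp, hR x x.2, rotate_one]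
  rw [hs] at e2
  exact e2

/-- The field at a site outside the cube is independent of the conditioning. -/
lemma condExp_norm_eq (hη : IsotropicDisorder P η) (e : Vec N) (L : ℕ) {x : Site d}
    (hx : x ∉ box d L) :
    P[fun ω => ‖η x ω‖ | componentAlgebra η e L] =ᵐ[P] fun _ => ∫ ω, ‖η 0 ω‖ ∂P := by
  have h1 := hη.indep.indepFun_finset {x} (box d L) (Finset.disjoint_singleton_left.2 hx)
    hη.measurable
  have h2 : IndepFun (fun ω => ‖η x ω‖)
      (fun ω (y : box d L) => (inner ℝ e (η y ω) : ℝ)) P :=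
    h1.comp (φ := fun v : ({x} : Finset (Site d)) → Vec N => ‖v ⟨x, Finset.mem_singleton_self x⟩‖)
      (ψ := fun (v : box d L → Vec N) y => (inner ℝ e (v y) : ℝ))
      (measurable_norm.comp (measurable_pi_apply _))
      (measurable_pi_iff.2 fun y =>
        (continuous_const.inner continuous_id).measurable.comp (measurable_pi_apply y))
  rw [← hη.integral_norm_eq x]
  refine condExp_indep_eq (hη.measurable x).norm.comap_le (hη.componentAlgebra_le e L) ?_ h2
  exact (comap_measurable _).stronglyMeasurable

end IsotropicDisorder

namespace SymmetricSystem

variable {ι : Type*} [Fintype ι] [DecidableEq ι] (S : SymmetricSystem d N ι)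

lemma abs_F_sub_le [Nonempty ι] {β : ENNReal} (hβ : β ≠ 0) (ε : ℝ) (K : ℕ) (h : Vec N)
    (η η' : Site d → Vec N) : |S.F β ε K h η - S.F β ε K h η'| ≤
      S.lopBound * |ε| * ∑ x ∈ box d K, ‖η x - η' x‖ := by
  rw [F, F, hamiltonian_eq_energy, hamiltonian_eq_energy]
  refine (S.abs_freeEnergy_energy_sub_le hβ K _ _).trans (le_of_eq ?_)
  rw [mul_assoc, Finset.mul_sum _ _ |ε|]
  congr 1
  refine Finset.sum_congr rfl fun x _ => ?_
  rw [add_sub_add_left_eq_sub, ← smul_sub, norm_smul, Real.norm_eq_abs]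

/-- The free energy is Lipschitz in finitely many field vectors, hence continuous for the product
topology; measurability follows. -/
lemma continuous_F [Nonempty ι] {β : ENNReal} (hβ : β ≠ 0) (ε : ℝ) (K : ℕ) (h : Vec N) :
    Continuous (S.F β ε K h) := by
  rw [continuous_iff_continuousAt]
  intro η
  rw [ContinuousAt, tendsto_iff_norm_sub_tendsto_zero]
  refine squeeze_zero (fun _ => norm_nonneg _) (fun η' => S.abs_F_sub_le hβ ε K h η' η) ?_
  have : Continuous fun η' : Site d → Vec N =>
      S.lopBound * |ε| * ∑ x ∈ box d K, ‖η' x - η x‖ := by fun_prop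
  have h2 := this.tendsto η
  simpa using h2

/-- The Lipschitz bound gives at most linear growth in the fields. The map `ρ` will be the identity
or `resetField L`. -/
lemma integrable_F [Nonempty ι] (hη : IsotropicDisorder P η) {β : ENNReal} (hβ : β ≠ 0) (ε : ℝ)
    (K : ℕ) (h : Vec N) {ρ : (Site d → Vec N) → Site d → Vec N} (hρ : Measurable ρ)
    (hnorm : ∀ v x, ‖ρ v x‖ ≤ ‖v x‖) :
    Integrable (fun ω => S.F β ε K h (ρ fun x => η x ω)) P := by
  have hb : Integrable (fun ω => |S.F β ε K h 0| +
      S.lopBound * |ε| * ∑ x ∈ box d K, ‖η x ω‖) P :=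
    (integrable_const _).add
      ((integrable_finsetSum _ fun x _ => hη.integrable_norm x).const_mul _)
  refine hb.mono' (((S.continuous_F hβ ε K h).measurable.comp
    (hρ.comp hη.measurable_field)).aestronglyMeasurable) (ae_of_all _ fun ω => ?_)
  have h1 := S.abs_F_sub_le hβ ε K h (ρ fun x => η x ω) 0
  have h2 : ∑ x ∈ box d K, ‖ρ (fun x => η x ω) x - (0 : Site d → Vec N) x‖ ≤
      ∑ x ∈ box d K, ‖η x ω‖ :=
    Finset.sum_le_sum fun x _ => by rw [Pi.zero_apply, sub_zero]; exact hnorm _ _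
  have h3 := mul_le_mul_of_nonneg_left h2 (mul_nonneg S.lopBound_nonneg (abs_nonneg ε))
  rw [Real.norm_eq_abs]
  have h4 := abs_sub_abs_le_abs_sub (S.F β ε K h (ρ fun x => η x ω)) (S.F β ε K h 0)
  linarith

/-- The conditional expectations of the free energies in opposite uniform fields are close. -/
lemma exists_condExp_F_le [Nonempty ι] (hN : 2 ≤ N) (hS : S.ShortRange)
    (hη : IsotropicDisorder P η) (ε : ℝ) :
    ∃ C : ℝ, ∀ (β : ENNReal), β ≠ 0 → ∀ e : Vec N, ‖e‖ = 1 → ∀ (L : ℕ), 1 ≤ L →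
      ∀ (K : ℕ) (δ : ℝ) (ρ : (Site d → Vec N) → Site d → Vec N), Measurable ρ →
      (∀ v x, ‖ρ v x‖ ≤ ‖v x‖) →
      (∀ (R : Site d → Matrix.specialOrthogonalGroup (Fin N) ℝ) v,
        ρ (fun x => rotate (R x) (v x)) = fun x => rotate (R x) (ρ v x)) →
      ∀ᵐ ω ∂P,
        (P[fun ω => S.F β ε K (δ • e) (ρ fun x => η x ω) | componentAlgebra η e L]) ω ≤
        (P[fun ω => S.F β ε K (-(δ • e)) (ρ fun x => η x ω) | componentAlgebra η e L]) ω +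
          C * (L ^ d / L ^ 2 + L ^ d * |δ|) := by
  obtain ⟨C, hC, hflip⟩ := S.exists_flip_bound hS ε
  have hμ₁0 : 0 ≤ ∫ ω, ‖η 0 ω‖ ∂P := integral_nonneg fun _ => norm_nonneg _
  have hcn := fun e L x => hη.condExp_norm_eq e L (x := x)
  generalize ∫ ω, ‖η 0 ω‖ ∂P = μ₁ at hμ₁0 hcn
  -- The second summand accounts for the mean total field norm on `B`, at most `C * L ^ d * μ₁`,
  -- multiplied by `C / L ^ 2`.
  refine ⟨C + C * C * μ₁, fun β hβ e he L hL K δ ρ hρ hnorm hrot => ?_⟩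
  obtain ⟨p, hp⟩ := exists_plane hN he
  obtain ⟨θ, B, h0, hB, hcard, hmain⟩ := hflip e p hp he L hL K
  have hΦm : Measurable fun v => S.F β ε K (δ • e) (ρ v) :=
    (S.continuous_F hβ ε K _).measurable.comp hρ
  have hi₀ := S.integrable_F hη hβ ε K (δ • e) hρ hnorm
  have hig := S.integrable_F hη hβ ε K (-(δ • e)) hρ hnorm
  have hi₁ := hη.integrable_comp_rotated (fun x => p.rot (θ x)) hΦm hi₀
  have hi₂ := hη.integrable_comp_rotated (fun x => p.rot (-θ x)) hΦm hi₀
  have hc₁ := hη.condExp_rotated e L (R := fun x => p.rot (θ x))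
    (fun x hx => by rw [h0 x hx, p.rot_zero]) hΦm hi₀
  have hc₂ := hη.condExp_rotated e L (R := fun x => p.rot (-θ x))
    (fun x hx => by rw [h0 x hx, neg_zero, p.rot_zero]) hΦm hi₀
  have hL0 : (0 : ℝ) < L := by exact_mod_cast hL
  have hpath : ∀ ω, (S.F β ε K (δ • e) (ρ fun x => rotate (p.rot (θ x)) (η x ω)) +
      S.F β ε K (δ • e) (ρ fun x => rotate (p.rot (-θ x)) (η x ω))) / 2 ≤
      S.F β ε K (-(δ • e)) (ρ fun x => η x ω) + (C * (L ^ d / L ^ 2) + C * L ^ d * |δ|) +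
        C / L ^ 2 * ∑ x ∈ B, ‖η x ω‖ := by
    intro ω
    have h1 := hmain β hβ δ (ρ fun x => η x ω)
    rw [← hrot (fun x => p.rot (θ x)), ← hrot (fun x => p.rot (-θ x)), add_assoc (S.F _ _ _ _ _)]
      at h1
    refine h1.trans (add_le_add le_rfl ?_)
    exact mul_le_mul_of_nonneg_left (Finset.sum_le_sum fun x _ => hnorm _ _) (by positivity)
  have hmain' := condExp_le_of_average_le (hη.componentAlgebra_le e L) hi₁ hi₂ hig hc₁ hc₂
    hη.integrable_norm (fun x hx => hcn e L x (hB x hx)) hpath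
  have harith : C * ((L : ℝ) ^ d / L ^ 2) + C * L ^ d * |δ| + C / L ^ 2 * (B.card * μ₁) ≤
      (C + C * C * μ₁) * (L ^ d / L ^ 2 + L ^ d * |δ|) := by
    have k11 : C / L ^ 2 * (B.card * μ₁) ≤ C / L ^ 2 * (C * L ^ d * μ₁) := by gcongr
    have k12 : 0 ≤ C * C * μ₁ * (L ^ d * |δ|) := by positivity
    have k13 : C / L ^ 2 * (C * L ^ d * μ₁) = C * C * μ₁ * (L ^ d / L ^ 2) := by ring
    linarith
  filter_upwards [hmain'] with ω k
  rw [add_assoc] at k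
  exact k.trans (add_le_add le_rfl harith)

lemma measurable_resetField (L : ℕ) :
    Measurable (resetField L : (Site d → Vec N) → Site d → Vec N) := by
  refine measurable_pi_iff.2 fun x => ?_
  unfold resetField
  split_ifs
  · exact measurable_const
  · exact measurable_pi_apply x

lemma norm_resetField_le (L : ℕ) (v : Site d → Vec N) (x : Site d) :
    ‖resetField L v x‖ ≤ ‖v x‖ := by
  unfold resetField
  split_ifs
  · rw [norm_zero]; exact norm_nonneg _
  · exact le_rfl

lemma resetField_rotate (L : ℕ) (R : Site d → Matrix.specialOrthogonalGroup (Fin N) ℝ)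
    (v : Site d → Vec N) :
    resetField L (fun x => rotate (R x) (v x)) = fun x => rotate (R x) (resetField L v x) := by
  ext1 x
  unfold resetField
  split_ifs
  · exact (rotate_zero _).symm
  · rfl

/-- The four free energies are paired by field configuration, `η` or its reset, and each pair
consists of opposite uniform fields. Using the one-sided comparison for `δ` and `-δ` bounds each
pair in absolute value by `b`, hence the half-sum by `b`; the mean costs another `b`. -/
lemma exists_freeEnergyDifference_le [Nonempty ι] (hN : 2 ≤ N) (hS : S.ShortRange)
    (hη : IsotropicDisorder P η) (ε : ℝ) :
    ∃ C : ℝ, ∀ (β : ENNReal), β ≠ 0 → ∀ e : Vec N, ‖e‖ = 1 → ∀ (L : ℕ), 1 ≤ L →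
      ∀ (K : ℕ) (δ : ℝ), ∀ᵐ ω ∂P, |S.freeEnergyDifference P η β ε e L K δ ω -
        ∫ ω', S.freeEnergyDifference P η β ε e L K δ ω' ∂P| ≤
          C * (L ^ d / L ^ 2 + L ^ d * |δ|) := by
  obtain ⟨C, hC⟩ := S.exists_condExp_F_le hN hS hη ε
  refine ⟨2 * C, fun β hβ e he L hL K δ => ?_⟩
  set b := C * (L ^ d / L ^ 2 + L ^ d * |δ|) with hb
  have hclose : ∀ ρ : (Site d → Vec N) → Site d → Vec N, Measurable ρ →
      (∀ v x, ‖ρ v x‖ ≤ ‖v x‖) →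
      (∀ (R : Site d → Matrix.specialOrthogonalGroup (Fin N) ℝ) v,
        ρ (fun x => rotate (R x) (v x)) = fun x => rotate (R x) (ρ v x)) →
      ∀ᵐ ω ∂P, |(P[fun ω => S.F β ε K (δ • e) (ρ fun x => η x ω) | componentAlgebra η e L]) ω -
        (P[fun ω => S.F β ε K (-(δ • e)) (ρ fun x => η x ω) | componentAlgebra η e L]) ω| ≤ b := by
    intro ρ h1 h2 h3
    have k2 := hC β hβ e he L hL K (-δ) ρ h1 h2 h3
    rw [neg_smul, neg_neg, abs_neg, ← hb] at k2
    filter_upwards [hC β hβ e he L hL K δ ρ h1 h2 h3, k2] with ω k1 k2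
    rw [abs_le]
    constructor <;> linarith
  have hid := hclose id measurable_id (fun _ _ => le_rfl) fun _ _ => rfl
  have hre := hclose (resetField L) (measurable_resetField L) (norm_resetField_le L)
    (resetField_rotate L)
  have hint : ∀ h : Vec N, Integrable (fun ω => S.F β ε K h fun x => η x ω) P := fun h =>
    S.integrable_F hη hβ ε K h (ρ := id) measurable_id fun _ _ => le_rfl
  have hintr : ∀ h : Vec N, Integrable (fun ω => S.F β ε K h (resetField L fun x => η x ω)) P :=
    fun h => S.integrable_F hη hβ ε K h (measurable_resetField L) (norm_resetField_le L)
  have hbound : ∀ᵐ ω ∂P, ‖S.freeEnergyDifference P η β ε e L K δ ω‖ ≤ b := by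
    filter_upwards [hid, hre,
      condExp_add (((hint (δ • e)).sub (hintr (δ • e))).sub (hint (-(δ • e)))) (hintr (-(δ • e)))
        (componentAlgebra η e L),
      condExp_sub ((hint (δ • e)).sub (hintr (δ • e))) (hint (-(δ • e))) (componentAlgebra η e L),
      condExp_sub (hint (δ • e)) (hintr (δ • e)) (componentAlgebra η e L)]
      with ω k1 k2 k3 k4 k5
    simp only [Pi.add_apply, Pi.sub_apply] at k3 k4 k5
    have k6 : S.freeEnergyDifference P η β ε e L K δ ω = (1 / 2 : ℝ) *
        (((P[fun ω => S.F β ε K (δ • e) fun x => η x ω | componentAlgebra η e L]) ω -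
        (P[fun ω => S.F β ε K (-(δ • e)) fun x => η x ω | componentAlgebra η e L]) ω) -
        ((P[fun ω => S.F β ε K (δ • e) (resetField L fun x => η x ω) |
          componentAlgebra η e L]) ω -
        (P[fun ω => S.F β ε K (-(δ • e)) (resetField L fun x => η x ω) |
          componentAlgebra η e L]) ω)) := by
      rw [freeEnergyDifference, Pi.smul_apply, smul_eq_mul]
      congr 1
      refine k3.trans ?_
      rw [k4, k5]
      ring
    rw [k6, Real.norm_eq_abs, abs_mul, abs_of_pos (by norm_num : (0 : ℝ) < 1 / 2)]
    have k7 := abs_sub (((P[fun ω => S.F β ε K (δ • e) fun x => η x ω | componentAlgebra η e L]) ω -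
        (P[fun ω => S.F β ε K (-(δ • e)) fun x => η x ω | componentAlgebra η e L]) ω))
        ((P[fun ω => S.F β ε K (δ • e) (resetField L fun x => η x ω) |
          componentAlgebra η e L]) ω -
        (P[fun ω => S.F β ε K (-(δ • e)) (resetField L fun x => η x ω) |
          componentAlgebra η e L]) ω)
    simp only [id] at k1
    linarith
  have hmean := norm_integral_le_of_norm_le_const hbound
  rw [probReal_univ, mul_one] at hmean
  filter_upwards [hbound] with ω k
  have := (norm_sub_le (S.freeEnergyDifference P η β ε e L K δ ω)
    (∫ ω', S.freeEnergyDifference P η β ε e L K δ ω' ∂P)).trans (add_le_add k hmean)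
  rw [Real.norm_eq_abs] at this
  linarith

end SymmetricSystem

end Disorder

end QuantumImryMa

end

/-! ### Passage to the limit. -/

theorem mainTheorem5 {d N : ℕ} (hN : 2 ≤ N) {ι : Type*} [Fintype ι] [DecidableEq ι] [Nonempty ι]
    (S : QuantumImryMa.SymmetricSystem d N ι) (hS : S.FiniteRange ∨ S.ShortRange)
    {Ω : Type*} [MeasurableSpace Ω] (P : Measure Ω) [IsProbabilityMeasure P]
    (η : QuantumImryMa.Site d → Ω → QuantumImryMa.Vec N)
    (hη : QuantumImryMa.IsotropicDisorder P η) (ε : ℝ) :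
    ∃ C : ℝ, ∀ (β : ENNReal), β ≠ 0 → ∀ e : QuantumImryMa.Vec N, ‖e‖ = 1 →
      ∀ (δ : ℕ → ℝ) (K : ℕ → ℕ), Tendsto δ atTop (𝓝 0) → Tendsto K atTop atTop →
      ∀ (L : ℕ), 1 ≤ L → ∀ G : Ω → ℝ, S.IsLimitFreeEnergyDifference P η β ε e δ K L G →
        ∀ᵐ ω ∂P, |G ω| ≤ C * (L : ℝ) ^ ((d : ℤ) - 2) := by
  have hS' : S.ShortRange := hS.elim (fun h => h.shortRange) id
  obtain ⟨C, hC⟩ := S.exists_freeEnergyDifference_le hN hS' hη ε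
  refine ⟨C, fun β hβ e he δ K hδ _ L hL G ⟨g, hg⟩ => ?_⟩
  have hall : ∀ᵐ ω ∂P, ∀ i j, |S.freeEnergyDifference P η β ε e L (K j) (δ i) ω -
      -- The bound does not depend on `K j`, and the pairs `(i, j)` are countable, so one null set
      -- serves for all of them. The term in `|δ i|` survives the limit in `j` and vanishes in the
      -- limit in `i`.
      ∫ ω', S.freeEnergyDifference P η β ε e L (K j) (δ i) ω' ∂P| ≤
        C * (L ^ d / L ^ 2 + L ^ d * |δ i|) :=
    ae_all_iff.2 fun i => ae_all_iff.2 fun j => hC β hβ e he L hL (K j) (δ i)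
  filter_upwards [hg, hall] with ω h1 h2
  have h3 : ∀ i, |g i ω| ≤ C * (L ^ d / L ^ 2 + L ^ d * |δ i|) := fun i =>
    le_of_tendsto (h1.1 i).abs (Eventually.of_forall fun j => h2 i j)
  have h4 : Tendsto (fun i => C * ((L : ℝ) ^ d / L ^ 2 + L ^ d * |δ i|)) atTop
      (𝓝 (C * ((L : ℝ) ^ d / L ^ 2 + L ^ d * |0|))) :=
    ((hδ.abs.const_mul _).const_add _).const_mul _
  have h5 := le_of_tendsto_of_tendsto' h1.2.abs h4 h3
  have hL0 : (L : ℝ) ≠ 0 := by exact_mod_cast (Nat.one_le_iff_ne_zero.1 hL)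
  rwa [abs_zero, mul_zero, add_zero, ← zpow_natCast, ← zpow_natCast (L : ℝ) 2, ← zpow_sub₀ hL0]
    at h5
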